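/- All Lie algebras are complex; $\mathfrak{so}_n$ is the Lie algebra of skew-symmetric complex $n\times n$ matrices, and $\mathfrak g_2$ is the exceptional simple Lie algebra of type $G_2$. For a subalgebra $\mathfrak h\subset\mathfrak g$ put $\mathfrak q=\mathfrak g/\mathfrak h$. For a finite-dimensional complex $\mathfrak h$-module $V$ and $Y\in\mathfrak h$ let $\rho_V(Y)=\frac12\sum_\lambda m_\lambda|\operatorname{Re}\lambda|$, where $\lambda$ runs over the eigenvalues of $Y$ on $V$ and $m_\lambda$ is the multiplicity of $\lambda$; here $V=\mathfrak h$ or $V=\mathfrak q$ with the adjoint action. Let $\mathfrak a\subset\mathfrak h$ be a maximal split abelian subspace, with a positive Weyl chamber $\mathfrak a_+$. We write $\rho_{\mathfrak h}\le\rho_{\mathfrak q}$ if $\rho_{\mathfrak h}(Y)\le\rho_{\mathfrak q}(Y)$ for all $Y\in\mathfrak a$, and $\rho_{\mathfrak h}<\rho_{\mathfrak q}$ if $\rho_{\mathfrak h}(Y)<\rho_{\mathfrak q}(Y)$ for all $Y\in\mathfrak a\setminus\{0\}$. A witness vector is a nonzero $Y$ with $\rho_{\mathfrak h}(Y)=\rho_{\mathfrak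 q}(Y)>0$. Coordinates. For $\mathfrak{so}_n$, $r=\lfloor n/2\rfloor$, take $\mathfrak a=\mathbb R^r$ with the roots $\pm\varepsilon_i\pm\varepsilon_j$ $(i<j)$ and, if $n$ is odd, also $\pm\varepsilon_i$; $\mathfrak a_+$ is given by $b_1\ge\dots\ge b_r\ge0$ if $n$ is odd and by $b_1\ge\dots\ge b_{r-1}\ge|b_r|$ if $n$ is even. For $\mathfrak g_2$ take $\mathfrak a=\{a\in\mathbb R^3: a_1+a_2+a_3=0\}$ with the simple roots $\alpha_1=\varepsilon_1-\varepsilon_2$, $\alpha_2=-2\varepsilon_1+\varepsilon_2+\varepsilon_3$; $\mathfrak a_+$ is given by $a_3\ge0\ge a_1\ge a_2$. For a direct sum take the direct sums of the $\mathfrak a$'s and the products of the chambers, with coordinates $(a_i)$ for the first and $(b_j)$ for the second summand. Let $q\ge1$. (1) Let $\mathfrak g=\mathfrak{so}_{7+q}$ and $\mathfrak h=\mathfrak g_2\oplus\mathfrak{so}_q\subset\mathfrak{so}_7\oplus\mathfrak{so}_q\subset\mathfrak{so}_{7+q}$, where $\mathfrak g_2\hookrightarrow\mathfrak{so}_7$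 is the $7$-dimensional irreducible representation. Then $$\rho_{\mathfrak h}\le\rho_{\mathfrak q}\iff 2\le q\le 9,\qquad \rho_{\mathfrak h}<\rho_{\mathfrak q}\iff 3\le q\le 8.$$ When $q=2$, an element $Y=(a_1,a_2,a_3,b_1)\in\mathfrak a_+$ is a witness vector if and only if $(a_1,a_2,a_3)\ne0$, $a_1=a_2$ and $b_1=0$. When $q=9$, an element $Y=(a_1,a_2,a_3,b_1,\dots,b_4)\in\mathfrak a_+$ is a witness vector if and only if $b_1>0$ and $a_1=a_2=a_3=b_2=b_3=b_4=0$. (2) Let $\mathfrak g=\mathfrak{so}_{8+q}$ and $\mathfrak h=\mathfrak{so}_7\oplus\mathfrak{so}_q\subset\mathfrak{so}_8\oplus\mathfrak{so}_q\subset\mathfrak{so}_{8+q}$, where $\mathfrak{so}_7\hookrightarrow\mathfrak{so}_8$ is the $8$-dimensional spin representation. Then $$\rho_{\mathfrak h}\le\rho_{\mathfrak q}\iff 3\le q\le 10,\qquad \rho_{\mathfrak h}<\rho_{\mathfrak q}\iff 4\le q\le 9.$$ When $q=3$, an element $Y=(a_1,a_2,a_3,b_1)\in\mathfrak a_+$ is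 a witness vector if and only if $a_1=a_2>0$ and $a_3=b_1=0$. When $q=10$, an element $Y=(a_1,a_2,a_3,b_1,\dots,b_5)\in\mathfrak a_+$ is a witness vector if and only if $b_1>0$ and $a_1=a_2=a_3=b_2=b_3=b_4=b_5=0$. -/

import Mathlib

open LieAlgebra.Orthogonal
open scoped Kronecker

attribute [local instance 100] LieRing.ofAssociativeRing

noncomputable section

namespace RhoIneq

/-! ### The functions `ρ` -/

/-- One half of the sum of `|Re z|` over the eigenvalues `z` of `T`, each taken with its algebraic
multiplicity. -/
def rhoEnd {V : Type*} [AddCommGroup V] [Module ℂ V] [Module.Finite ℂ V]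
    (T : Module.End ℂ V) : ℝ :=
  (1 / 2) * (T.charpoly.roots.map fun z : ℂ => |z.re|).sum

section Pair

variable {g : Type*} [LieRing g] [LieAlgebra ℂ g] [Module.Finite ℂ g] (h : LieSubalgebra ℂ g)

instance : Module.Finite ℂ h := inferInstanceAs (Module.Finite ℂ h.toSubmodule)

instance : Module.Finite ℂ (g ⧸ h.toLieSubmodule) :=
  inferInstanceAs (Module.Finite ℂ (g ⧸ h.toLieSubmodule.toSubmodule))

/-- `ρ_h`, for the adjoint representation of `h`. -/
def rhoSub (Y : h) : ℝ := rhoEnd (LieModule.toEnd ℂ h h Y)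

/-- `ρ_q`, for the `h`-module `q = g / h`. -/
def rhoQuot (Y : h) : ℝ := rhoEnd (LieModule.toEnd ℂ h (g ⧸ h.toLieSubmodule) Y)

/-- `ρ_h ≤ ρ_q` on `a`. -/
def RhoLE (a : Set h) : Prop := ∀ Y ∈ a, rhoSub h Y ≤ rhoQuot h Y

/-- `ρ_h < ρ_q` on `a \ {0}`. -/
def RhoLT (a : Set h) : Prop := ∀ Y ∈ a, Y ≠ 0 → rhoSub h Y < rhoQuot h Y

/-- A witness vector: a nonzero `Y` with `ρ_h Y = ρ_q Y > 0`. -/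
def IsWitness (Y : h) : Prop := Y ≠ 0 ∧ rhoSub h Y = rhoQuot h Y ∧ 0 < rhoQuot h Y

end Pair

/-! ### Orthogonal Lie algebras

`so n ℂ` is the Lie algebra of skew-symmetric complex matrices with index set `n`. -/

section Orth

variable {m n : Type*} [Fintype m] [DecidableEq m] [Fintype n] [DecidableEq n]

/-- The skew-symmetric matrix `u vᵀ - v uᵀ`. -/
def wedge (u v : n → ℂ) : so n ℂ :=
  ⟨Matrix.vecMulVec u v - Matrix.vecMulVec v u, by
    rw [mem_so, Matrix.transpose_sub, Matrix.transpose_vecMulVec, Matrix.transpose_vecMulVec,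
      neg_sub]⟩

/-- The inclusion of `so_m ⊕ so_n` in `so_{m+n}` by block diagonal matrices. -/
def blockDiag : so m ℂ × so n ℂ →ₗ⁅ℂ⁆ so (m ⊕ n) ℂ where
  toFun A := ⟨Matrix.fromBlocks A.1 0 0 A.2, by
    have h1 := (mem_so _ _ _).1 A.1.2
    have h2 := (mem_so _ _ _).1 A.2.2
    rw [mem_so, Matrix.fromBlocks_transpose, h1, h2, Matrix.fromBlocks_neg]
    simp⟩
  map_add' A B := by
    apply Subtype.ext
    simp [Matrix.fromBlocks_add]
  map_smul' c A := by
    apply Subtype.ext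
    simp [Matrix.fromBlocks_smul]
  map_lie' {A B} := by
    apply Subtype.ext
    simp [LieRing.of_associative_ring_bracket, Matrix.fromBlocks_multiply, sub_eq_add_neg,
      Matrix.fromBlocks_add, Matrix.fromBlocks_neg]

end Orth

/-- The Cartan subalgebra of `so_n`: the block diagonal matrix with the blocks
`[[0, -i bₖ], [i bₖ, 0]]` for `k < ⌊n/2⌋` (and a final zero if `n` is odd), with the eigenvalues
`± bₖ` (and `0`). Its roots are `± εᵢ ± εⱼ` for `i < j`, and also `± εᵢ` if `n` is odd. Real `b`
give the maximal split abelian subspace `ℝ^⌊n/2⌋`. -/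
def soTorus (n : ℕ) (b : Fin (n / 2) → ℝ) : so (Fin n) ℂ :=
  ∑ k : Fin (n / 2), (-Complex.I * (b k : ℂ)) •
    wedge (Pi.single ⟨2 * k, by omega⟩ 1) (Pi.single ⟨2 * k + 1, by omega⟩ 1)

/-- The positive Weyl chamber of `so_n`: `b₁ ≥ ⋯ ≥ b_r ≥ 0` if `n = 2r + 1`, and
`b₁ ≥ ⋯ ≥ b_{r-1} ≥ |b_r|` if `n = 2r`. -/
def soChamber (n : ℕ) : Set (Fin (n / 2) → ℝ) :=
  {b | (∀ i j, i < j → |b j| ≤ b i) ∧ (Odd n → ∀ i, 0 ≤ b i)}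

/-! ### `g₂` and its seven-dimensional representation

`LieAlgebra.g₂ ℂ` is the complex Lie algebra with Chevalley generators `H i`, `E i`, `F i`
(`i = 0, 1`) and the Cartan matrix `!![2, -3; -1, 2]`: the short simple root `α₁` belongs to
`i = 0`, the long simple root `α₂` to `i = 1`, and `⁅H i, E j⁆ = CM i j • E j`. -/

section G2

open CartanMatrix

/-- The vectors `eₖ + i eₖ'` (weights `εₖ`), where `e₁, e₁', e₂, e₂', e₃, e₃', e₀` is the standard
basis of `ℂ⁷`. -/
def wtPos (k : Fin 3) : Fin 7 → ℂ :=
  Pi.single ⟨2 * k, by omega⟩ 1 + Complex.I • Pi.single ⟨2 * k + 1, by omega⟩ 1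

/-- The vectors `eₖ - i eₖ'` (weights `-εₖ`). -/
def wtNeg (k : Fin 3) : Fin 7 → ℂ :=
  Pi.single ⟨2 * k, by omega⟩ 1 - Complex.I • Pi.single ⟨2 * k + 1, by omega⟩ 1

/-- The vector `e₀` (weight zero). -/
def wtZero : Fin 7 → ℂ := Pi.single 6 1

/-- The images in `so_7` of the Chevalley generators of `g₂`. The weights `ε₁, ε₂, ε₃` of
`so_7` restrict to `2α₁ + α₂`, `α₁ + α₂`, `α₁`. -/
def g2Gen : Generators (Fin 2) → so (Fin 7) ℂ
  | .H 0 => (1 / 2 : ℂ) • wedge (wtPos 0) (wtNeg 0) - (1 / 2 : ℂ) • wedge (wtPos 1) (wtNeg 1)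
      + wedge (wtPos 2) (wtNeg 2)
  | .H 1 => (1 / 2 : ℂ) • wedge (wtPos 1) (wtNeg 1) - (1 / 2 : ℂ) • wedge (wtPos 2) (wtNeg 2)
  | .E 0 => (1 / 2 : ℂ) • wedge (wtPos 0) (wtNeg 1) + wedge (wtPos 2) wtZero
  | .E 1 => (1 / 2 : ℂ) • wedge (wtPos 1) (wtNeg 2)
  | .F 0 => (1 / 2 : ℂ) • wedge (wtPos 1) (wtNeg 0) - wedge (wtNeg 2) wtZero
  | .F 1 => (1 / 2 : ℂ) • wedge (wtPos 2) (wtNeg 1)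

theorem wedge_lie {n : Type*} [Fintype n] [DecidableEq n] (u v x y : n → ℂ) :
    ⁅wedge u v, wedge x y⁆ = (v ⬝ᵥ x) • wedge u y - (v ⬝ᵥ y) • wedge u x
      - (u ⬝ᵥ x) • wedge v y + (u ⬝ᵥ y) • wedge v x := by
  apply Subtype.ext
  change (Matrix.vecMulVec u v - Matrix.vecMulVec v u) *
      (Matrix.vecMulVec x y - Matrix.vecMulVec y x) -
      (Matrix.vecMulVec x y - Matrix.vecMulVec y x) *
      (Matrix.vecMulVec u v - Matrix.vecMulVec v u) =
    (v ⬝ᵥ x) • (Matrix.vecMulVec u y - Matrix.vecMulVec y u)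
      - (v ⬝ᵥ y) • (Matrix.vecMulVec u x - Matrix.vecMulVec x u)
      - (u ⬝ᵥ x) • (Matrix.vecMulVec v y - Matrix.vecMulVec y v)
      + (u ⬝ᵥ y) • (Matrix.vecMulVec v x - Matrix.vecMulVec x v)
  simp only [sub_mul, mul_sub, Matrix.vecMulVec_mul_vecMulVec, Matrix.vecMulVec_smul,
    dotProduct_comm x, dotProduct_comm y]
  module

theorem wedge_swap {n : Type*} [Fintype n] [DecidableEq n] (u v : n → ℂ) :
    wedge u v = - wedge v u := by
  apply Subtype.ext
  change Matrix.vecMulVec u v - Matrix.vecMulVec v u =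
    -(Matrix.vecMulVec v u - Matrix.vecMulVec u v)
  abel

theorem wedge_self {n : Type*} [Fintype n] [DecidableEq n] (u : n → ℂ) :
    wedge u u = 0 := by
  apply Subtype.ext
  change Matrix.vecMulVec u u - Matrix.vecMulVec u u = 0
  abel

theorem dot_pos_pos (j k : Fin 3) : wtPos j ⬝ᵥ wtPos k = 0 := by
  fin_cases j <;> fin_cases k <;> simp [wtPos, Fin.sum_univ_succ, dotProduct, Pi.single_apply]

theorem dot_neg_neg (j k : Fin 3) : wtNeg j ⬝ᵥ wtNeg k = 0 := by
  fin_cases j <;> fin_cases k <;> simp [wtNeg, Fin.sum_univ_succ, dotProduct, Pi.single_apply]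

theorem dot_pos_neg (j k : Fin 3) : wtPos j ⬝ᵥ wtNeg k = if j = k then 2 else 0 := by
  fin_cases j <;> fin_cases k <;>
    simp [wtPos, wtNeg, Fin.sum_univ_succ, dotProduct, Pi.single_apply] <;> norm_num

theorem dot_neg_pos (j k : Fin 3) : wtNeg j ⬝ᵥ wtPos k = if j = k then 2 else 0 := by
  fin_cases j <;> fin_cases k <;>
    simp [wtPos, wtNeg, Fin.sum_univ_succ, dotProduct, Pi.single_apply] <;> norm_num

theorem dot_pos_zero (j : Fin 3) : wtPos j ⬝ᵥ wtZero = 0 := by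
  fin_cases j <;> simp [wtPos, wtZero, dotProduct, Pi.single_apply]

theorem dot_neg_zero (j : Fin 3) : wtNeg j ⬝ᵥ wtZero = 0 := by
  fin_cases j <;> simp [wtNeg, wtZero, dotProduct, Pi.single_apply]

theorem dot_zero_pos (j : Fin 3) : wtZero ⬝ᵥ wtPos j = 0 := by
  rw [dotProduct_comm, dot_pos_zero]

theorem dot_zero_neg (j : Fin 3) : wtZero ⬝ᵥ wtNeg j = 0 := by
  rw [dotProduct_comm, dot_neg_zero]

theorem dot_zero_zero : wtZero ⬝ᵥ wtZero = 1 := by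
  simp [wtZero]

/-- The matrices `g2Gen` satisfy the defining relations of `g₂`. -/
theorem g2Gen_rel (x : FreeLieAlgebra ℂ (Generators (Fin 2)))
    (hx : x ∈ Relations.toSet ℂ G₂) : FreeLieAlgebra.lift ℂ g2Gen x = 0 := by
  have key : ∀ i j : Fin 2,
      ⁅g2Gen (.H i), g2Gen (.H j)⁆ = 0 ∧
      ⁅g2Gen (.E i), g2Gen (.F j)⁆ = (if i = j then g2Gen (.H i) else 0) ∧
      ⁅g2Gen (.H i), g2Gen (.E j)⁆ = G₂ i j • g2Gen (.E j) ∧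
      ⁅g2Gen (.H i), g2Gen (.F j)⁆ = -(G₂ i j • g2Gen (.F j)) ∧
      (fun z => ⁅g2Gen (.E i), z⁆)^[(-G₂ i j).toNat] ⁅g2Gen (.E i), g2Gen (.E j)⁆ = 0 ∧
      (fun z => ⁅g2Gen (.F i), z⁆)^[(-G₂ i j).toNat] ⁅g2Gen (.F i), g2Gen (.F j)⁆ = 0 := by
    intro i j
    have sw (a b : Fin 3) : wedge (wtNeg a) (wtPos b) = -wedge (wtPos b) (wtNeg a) :=
      wedge_swap _ _
    fin_cases i <;> fin_cases j <;> refine ⟨?_, ?_, ?_, ?_, ?_, ?_⟩ <;>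
      simp [g2Gen, G₂, wedge_lie, dot_pos_pos, dot_neg_neg, dot_pos_neg, dot_neg_pos,
        dot_pos_zero, dot_neg_zero, dot_zero_pos, dot_zero_neg, dot_zero_zero, wedge_self, sw] <;>
      module
  have adPow (a y : FreeLieAlgebra ℂ (Generators (Fin 2))) (k : ℕ) :
      FreeLieAlgebra.lift ℂ g2Gen ((LieAlgebra.ad ℂ _ a ^ k) y) =
        (fun z => ⁅FreeLieAlgebra.lift ℂ g2Gen a, z⁆)^[k] (FreeLieAlgebra.lift ℂ g2Gen y) := by
    induction k with
    | zero => simp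
    | succ k ih =>
      rw [pow_succ', Function.iterate_succ_apply', ← ih]
      simp
  rcases hx with ((((⟨⟨i, j⟩, rfl⟩ | ⟨⟨i, j⟩, rfl⟩) | ⟨⟨i, j⟩, rfl⟩) | ⟨⟨i, j⟩, rfl⟩) |
    ⟨⟨i, j⟩, rfl⟩) | ⟨⟨i, j⟩, rfl⟩
  · simpa [Relations.HH] using (key i j).1
  · have h := (key i j).2.1
    by_cases hij : i = j
    · subst hij
      simpa [Relations.EF, sub_eq_zero] using h
    · simpa [Relations.EF, hij] using h
  · simpa [Relations.HE, sub_eq_zero] using (key i j).2.2.1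
  · simpa [Relations.HF, add_eq_zero_iff_eq_neg] using (key i j).2.2.2.1
  · have h := (key i j).2.2.2.2.1
    simp only [Relations.adE, Function.uncurry_apply_pair, adPow]
    simpa using h
  · have h := (key i j).2.2.2.2.2
    simp only [Relations.adF, Function.uncurry_apply_pair, adPow]
    simpa using h

theorem g2_toIdeal_le_ker :
    Relations.toIdeal ℂ G₂ ≤ (FreeLieAlgebra.lift ℂ g2Gen).ker :=
  LieSubmodule.lieSpan_le.2 fun x hx => (LieHom.mem_ker).2 (g2Gen_rel x hx)

/-- The seven-dimensional representation `g₂ → so_7`: the homomorphism with the values `g2Gen` on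
the Chevalley generators. -/
def g2Rep : LieAlgebra.g₂ ℂ →ₗ⁅ℂ⁆ so (Fin 7) ℂ :=
  { (Relations.toIdeal ℂ G₂).toSubmodule.liftQ
      (FreeLieAlgebra.lift ℂ g2Gen : FreeLieAlgebra ℂ (Generators (Fin 2)) →ₗ[ℂ] so (Fin 7) ℂ)
      (fun x hx => (LieHom.mem_ker).1 (g2_toIdeal_le_ker hx)) with
    map_lie' := by
      rintro ⟨x⟩ ⟨y⟩
      exact (FreeLieAlgebra.lift ℂ g2Gen).map_lie x y }

/-- The Chevalley generator `H i` of `g₂`. -/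
def g2H (i : Fin 2) : LieAlgebra.g₂ ℂ :=
  LieSubmodule.Quotient.mk (N := Relations.toIdeal ℂ G₂) (FreeLieAlgebra.of ℂ (.H i))

theorem g2Rep_g2H (i : Fin 2) : g2Rep (g2H i) = g2Gen (.H i) :=
  FreeLieAlgebra.lift_of_apply (R := ℂ) g2Gen (.H i)

/-- The maximal split abelian subspace of `g₂`, as the space of all `a ∈ ℝ³` with
`a₁ + a₂ + a₃ = 0`. -/
def g2Split : Set (Fin 3 → ℝ) := {a | a 0 + a 1 + a 2 = 0}

/-- The element of the Cartan subalgebra of `g₂` with the coordinates `(a₁, a₂, a₃)`. In them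
`α₁ = ε₁ - ε₂` and `α₂ = -2ε₁ + ε₂ + ε₃`, hence the coroots are `H 0 = (1, -1, 0)` and
`H 1 = (-2, 1, 1) / 3`. -/
def g2Torus (a : Fin 3 → ℝ) : LieAlgebra.g₂ ℂ :=
  ((a 2 - a 1 : ℝ) : ℂ) • g2H 0 + ((3 * a 2 : ℝ) : ℂ) • g2H 1

/-- The positive Weyl chamber of `g₂`: `a₃ ≥ 0 ≥ a₁ ≥ a₂`. -/
def g2Chamber : Set (Fin 3 → ℝ) := {a | a ∈ g2Split ∧ a 1 ≤ a 0 ∧ a 0 ≤ 0 ∧ 0 ≤ a 2}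

end G2

/-! ### The spin representation of `so_7` -/

section Spin

/-- An index set with eight elements. -/
abbrev I8 : Type := Fin 2 × Fin 2 × Fin 2

/-- The skew-symmetric matrix `[[0, 1], [-1, 0]]`. -/
def mE : Matrix (Fin 2) (Fin 2) ℂ := !![0, 1; -1, 0]

/-- The symmetric matrix `[[0, 1], [1, 0]]`. -/
def mS : Matrix (Fin 2) (Fin 2) ℂ := !![0, 1; 1, 0]

/-- The symmetric matrix `diag(1, -1)`. -/
def mT : Matrix (Fin 2) (Fin 2) ℂ := !![1, 0; 0, -1]

/-- Seven skew-symmetric `8 × 8` matrices with `γᵢ γⱼ + γⱼ γᵢ = -2 δᵢⱼ`. -/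
def gamma : Fin 7 → Matrix I8 I8 ℂ :=
  ![mE ⊗ₖ (mS ⊗ₖ 1), mE ⊗ₖ (mT ⊗ₖ 1), 1 ⊗ₖ (mE ⊗ₖ mS), 1 ⊗ₖ (mE ⊗ₖ mT),
    mS ⊗ₖ (1 ⊗ₖ mE), mT ⊗ₖ (1 ⊗ₖ mE), mE ⊗ₖ (mE ⊗ₖ mE)]

theorem neg_kron {m n : Type*} (A : Matrix m m ℂ) (B : Matrix n n ℂ) :
    (-A) ⊗ₖ B = -(A ⊗ₖ B) := by
  ext; simp [Matrix.kroneckerMap_apply]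

theorem kron_neg {m n : Type*} (A : Matrix m m ℂ) (B : Matrix n n ℂ) :
    A ⊗ₖ (-B) = -(A ⊗ₖ B) := by
  ext; simp [Matrix.kroneckerMap_apply]

theorem mE_transpose : mE.transpose = -mE := by
  ext a b; fin_cases a <;> fin_cases b <;> simp [mE]

theorem mS_transpose : mS.transpose = mS := by
  ext a b; fin_cases a <;> fin_cases b <;> simp [mS]

theorem mT_transpose : mT.transpose = mT := by
  ext a b; fin_cases a <;> fin_cases b <;> simp [mT]

theorem gamma_transpose (i : Fin 7) : (gamma i).transpose = -gamma i := by
  fin_cases i <;> simp [gamma, ← Matrix.kroneckerMap_transpose,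
    mE_transpose, mS_transpose, mT_transpose, neg_kron, kron_neg]

theorem gamma_anticomm (i j : Fin 7) :
    gamma i * gamma j + gamma j * gamma i = if i = j then -2 else 0 := by
  have ee : mE * mE = -1 := by ext a b; fin_cases a <;> fin_cases b <;> simp [mE]
  have ss : mS * mS = 1 := by ext a b; fin_cases a <;> fin_cases b <;> simp [mS]
  have tt : mT * mT = 1 := by ext a b; fin_cases a <;> fin_cases b <;> simp [mT]
  have es : mE * mS = mT := by ext a b; fin_cases a <;> fin_cases b <;> simp [mE, mS, mT]
  have se : mS * mE = -mT := by ext a b; fin_cases a <;> fin_cases b <;> simp [mE, mS, mT]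
  have et : mE * mT = -mS := by ext a b; fin_cases a <;> fin_cases b <;> simp [mE, mS, mT]
  have te : mT * mE = mS := by ext a b; fin_cases a <;> fin_cases b <;> simp [mE, mS, mT]
  have st : mS * mT = -mE := by ext a b; fin_cases a <;> fin_cases b <;> simp [mE, mS, mT]
  have ts : mT * mS = mE := by ext a b; fin_cases a <;> fin_cases b <;> simp [mE, mS, mT]
  have two : (-1 + -1 : Matrix I8 I8 ℂ) = -2 := by norm_num
  fin_cases i <;> fin_cases j <;>
    simp [gamma, ← Matrix.mul_kronecker_mul, ee, ss, tt, es, se, et, te, st, ts, neg_kron,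
      kron_neg, two]

/-- The matrix `-(1/4) ∑ Aᵢⱼ γᵢ γⱼ`. -/
def spinMat (A : Matrix (Fin 7) (Fin 7) ℂ) : Matrix I8 I8 ℂ :=
  (-1 / 4 : ℂ) • ∑ i, ∑ j, A i j • (gamma i * gamma j)

theorem spinMat_mem (A : Matrix (Fin 7) (Fin 7) ℂ) (hA : A.transpose = -A) :
    spinMat A ∈ so I8 ℂ := by
  rw [mem_so, spinMat, Matrix.transpose_smul, ← smul_neg]
  congr 1
  simp only [Matrix.transpose_sum, Matrix.transpose_smul, Matrix.transpose_mul, gamma_transpose,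
    neg_mul_neg]
  rw [Finset.sum_comm, ← Finset.sum_neg_distrib]
  refine Finset.sum_congr rfl fun i _ => ?_
  rw [← Finset.sum_neg_distrib]
  refine Finset.sum_congr rfl fun j _ => ?_
  have h : A j i = -A i j := congrFun (congrFun hA i) j
  rw [h, neg_smul]

/-- `[spinMat A, γₖ] = ∑ Aᵢₖ γᵢ`. -/
theorem spinMat_gamma (A : Matrix (Fin 7) (Fin 7) ℂ) (hA : A.transpose = -A) (k : Fin 7) :
    spinMat A * gamma k - gamma k * spinMat A = ∑ i, A i k • gamma i := by
  have h1 (i j : Fin 7) : gamma i * gamma j * gamma k - gamma k * (gamma i * gamma j) =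
      (if j = k then (-2 : ℂ) else 0) • gamma i - (if i = k then (-2 : ℂ) else 0) • gamma j := by
    have hj : gamma j * gamma k = (if j = k then -2 else 0) - gamma k * gamma j :=
      eq_sub_of_add_eq (gamma_anticomm j k)
    have hi : gamma i * gamma k = (if i = k then -2 else 0) - gamma k * gamma i :=
      eq_sub_of_add_eq (gamma_anticomm i k)
    rw [mul_assoc, hj, mul_sub, ← mul_assoc (gamma i), hi, sub_mul, ← mul_assoc (gamma k)]
    have c1 (p : Prop) [Decidable p] (M : Matrix I8 I8 ℂ) :
        M * (if p then -2 else 0) = (if p then (-2 : ℂ) else 0) • M := by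
      split_ifs
      · rw [neg_smul, mul_neg, mul_two, two_smul]
      · simp
    have c2 (p : Prop) [Decidable p] (M : Matrix I8 I8 ℂ) :
        (if p then -2 else 0) * M = (if p then (-2 : ℂ) else 0) • M := by
      split_ifs
      · rw [neg_smul, neg_mul, two_mul, two_smul]
      · simp
    rw [c1, c2]
    abel
  have h2 : spinMat A * gamma k - gamma k * spinMat A = (-1 / 4 : ℂ) • ∑ i, ∑ j, A i j •
      (gamma i * gamma j * gamma k - gamma k * (gamma i * gamma j)) := by
    simp only [spinMat, Matrix.smul_mul, Matrix.mul_smul, Finset.sum_mul, Finset.mul_sum,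
      smul_sub, Finset.sum_sub_distrib]
  have h4 : ∑ i, ∑ j, A i j • ((if j = k then (-2 : ℂ) else 0) • gamma i) =
      ∑ i, (-2 : ℂ) • A i k • gamma i := by
    refine Finset.sum_congr rfl fun i _ => ?_
    rw [Finset.sum_eq_single k (fun j _ hj => by rw [if_neg hj, zero_smul, smul_zero])
      (fun h => absurd (Finset.mem_univ k) h), if_pos rfl, smul_comm]
  have h5 : ∑ i, ∑ j, A i j • ((if i = k then (-2 : ℂ) else 0) • gamma j) =
      ∑ i, (2 : ℂ) • A i k • gamma i := by
    rw [Finset.sum_comm]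
    refine Finset.sum_congr rfl fun i _ => ?_
    have h3 : A k i = -A i k := congrFun (congrFun hA i) k
    rw [Finset.sum_eq_single k (fun j _ hj => by rw [if_neg hj, zero_smul, smul_zero])
      (fun h => absurd (Finset.mem_univ k) h), if_pos rfl, h3]
    module
  rw [h2]
  simp only [h1, smul_sub, Finset.sum_sub_distrib]
  rw [h4, h5, ← smul_sub, ← Finset.sum_sub_distrib, Finset.smul_sum]
  refine Finset.sum_congr rfl fun i _ => ?_
  module

theorem spinMat_lie (A B : Matrix (Fin 7) (Fin 7) ℂ) (hA : A.transpose = -A) :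
    spinMat (A * B - B * A) = spinMat A * spinMat B - spinMat B * spinMat A := by
  have h1 (k l : Fin 7) : spinMat A * (gamma k * gamma l) - gamma k * gamma l * spinMat A =
      ∑ i, A i k • (gamma i * gamma l) + ∑ i, A i l • (gamma k * gamma i) := by
    have hk := spinMat_gamma A hA k
    have hl := spinMat_gamma A hA l
    calc _ = (spinMat A * gamma k - gamma k * spinMat A) * gamma l +
          gamma k * (spinMat A * gamma l - gamma l * spinMat A) := by noncomm_ring
      _ = _ := by
        rw [hk, hl]
        simp only [Finset.sum_mul, Finset.mul_sum, Matrix.smul_mul, Matrix.mul_smul]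
  have h2 : spinMat A * spinMat B - spinMat B * spinMat A = (-1 / 4 : ℂ) • ∑ k, ∑ l, B k l •
      (spinMat A * (gamma k * gamma l) - gamma k * gamma l * spinMat A) := by
    conv_lhs => rw [spinMat.eq_def B]
    simp only [Matrix.smul_mul, Matrix.mul_smul, Finset.sum_mul, Finset.mul_sum,
      smul_sub, Finset.sum_sub_distrib]
  have h3 (i j : Fin 7) : A i j = -A j i := congrFun (congrFun hA j) i
  rw [h2, spinMat]
  congr 1
  have e1 : ∑ i, ∑ l, (A * B) i l • (gamma i * gamma l) =
      ∑ k, ∑ l, B k l • ∑ i, A i k • (gamma i * gamma l) := by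
    simp only [Matrix.mul_apply, Finset.sum_smul, Finset.smul_sum]
    calc _ = ∑ i, ∑ k, ∑ l, (A i k * B k l) • (gamma i * gamma l) :=
          Finset.sum_congr rfl fun i _ => Finset.sum_comm
      _ = ∑ k, ∑ i, ∑ l, (A i k * B k l) • (gamma i * gamma l) := Finset.sum_comm
      _ = _ := by
        refine Finset.sum_congr rfl fun k _ => ?_
        rw [Finset.sum_comm]
        refine Finset.sum_congr rfl fun l _ => Finset.sum_congr rfl fun i _ => ?_
        rw [smul_smul, mul_comm]
  have e2 : ∑ k, ∑ i, (B * A) k i • (gamma k * gamma i) =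
      -∑ k, ∑ l, B k l • ∑ i, A i l • (gamma k * gamma i) := by
    simp only [Matrix.mul_apply, Finset.sum_smul, Finset.smul_sum]
    rw [← Finset.sum_neg_distrib]
    refine Finset.sum_congr rfl fun k _ => ?_
    rw [Finset.sum_comm, ← Finset.sum_neg_distrib]
    refine Finset.sum_congr rfl fun l _ => ?_
    rw [← Finset.sum_neg_distrib]
    refine Finset.sum_congr rfl fun i _ => ?_
    rw [h3 l i, smul_smul, mul_neg, neg_smul]
  simp only [h1, smul_add, Finset.sum_add_distrib, Matrix.sub_apply, sub_smul,
    Finset.sum_sub_distrib]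
  rw [e1, e2, sub_neg_eq_add]

/-- The spin representation `so_7 → so_8`: the Lie algebra homomorphism with
`A ↦ -(1/4) ∑ Aᵢⱼ γᵢ γⱼ`, obtained from the action of the even Clifford algebra on `ℂ⁸`. -/
def spinRep : so (Fin 7) ℂ →ₗ⁅ℂ⁆ so I8 ℂ where
  toFun A := ⟨spinMat A, spinMat_mem A ((mem_so _ _ _).1 A.2)⟩
  map_add' A B := by
    apply Subtype.ext
    simp [spinMat, add_smul, Finset.sum_add_distrib]
  map_smul' c A := by
    apply Subtype.ext
    simp [spinMat, mul_smul, Finset.smul_sum, smul_comm c]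
  map_lie' {A B} := by
    apply Subtype.ext
    exact spinMat_lie A B ((mem_so _ _ _).1 A.2)

end Spin

/-! ### The two families of pairs -/

section Pairs

variable {k : Type*} [LieRing k] [LieAlgebra ℂ k] {m : Type*} [Fintype m] [DecidableEq m]

/-- For a homomorphism `π : k → so_m`, the homomorphism `k ⊕ so_q → so_m ⊕ so_q → so_{m+q}`. -/
def pairHom (π : k →ₗ⁅ℂ⁆ so m ℂ) (q : ℕ) : k × so (Fin q) ℂ →ₗ⁅ℂ⁆ so (m ⊕ Fin q) ℂ :=
  blockDiag.comp (π.prodMap LieHom.id)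

end Pairs

/-- The subalgebra `g₂ ⊕ so_q` of `so_{7+q}`. -/
def hG2 (q : ℕ) : LieSubalgebra ℂ (so (Fin 7 ⊕ Fin q) ℂ) := (pairHom g2Rep q).range

/-- The element of `g₂ ⊕ so_q` with the coordinates `(a₁, a₂, a₃, b₁, …, b_{⌊q/2⌋})`. -/
def vecG2 (q : ℕ) (a : Fin 3 → ℝ) (b : Fin (q / 2) → ℝ) : hG2 q :=
  (pairHom g2Rep q).rangeRestrict (g2Torus a, soTorus q b)

/-- The maximal split abelian subspace of `g₂ ⊕ so_q`. -/
def aG2 (q : ℕ) : Set (hG2 q) := {Y | ∃ a ∈ g2Split, ∃ b, Y = vecG2 q a b}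

/-- The subalgebra `so_7 ⊕ so_q` of `so_{8+q}`, with `so_7` embedded by the spin representation. -/
def hSpin (q : ℕ) : LieSubalgebra ℂ (so (I8 ⊕ Fin q) ℂ) := (pairHom spinRep q).range

/-- The element of `so_7 ⊕ so_q` with the coordinates `(a₁, a₂, a₃, b₁, …, b_{⌊q/2⌋})`. -/
def vecSpin (q : ℕ) (a : Fin 3 → ℝ) (b : Fin (q / 2) → ℝ) : hSpin q :=
  (pairHom spinRep q).rangeRestrict (soTorus 7 a, soTorus q b)

/-- The maximal split abelian subspace of `so_7 ⊕ so_q`. -/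
def aSpin (q : ℕ) : Set (hSpin q) := {Y | ∃ a b, Y = vecSpin q a b}

end RhoIneq

end

open RhoIneq

/-!
Since `ρ` is additive in exact sequences, `ρ_q = ρ_g - ρ_h` (`rhoSub_add_rhoQuot`), so only the
adjoint representations of `g = so_{m+q}` and of `h` matter, with `m = 7` or `m = 8`. The adjoint
representation of `so_n` is `Λ² ℂⁿ`; if `Y` acts on `ℂⁿ` with the eigenvalues `wᵢ`, it acts there
with the eigenvalues `wᵢ + wⱼ`, `i < j` (`rhoEnd_ad_so`). Explicit eigenbases for the Cartan
subalgebras of `so_q` and for the spin representation reduce this to sums over weights. For `g₂`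
the image in `so_7` is determined from the Serre generators: it has the basis `g2Vec` of 12 root
vectors and 2 coroots, so nothing about the abstract Lie algebra `g₂` is needed.

The result is a formula for `ρ_q - ρ_h`. Write `q = 2r + δ` with `δ ∈ {0, 1}`, and let
`t₀ ≤ t₁ ≤ ⋯` be the sorted `|bⱼ|`. The nonzero weights of `g₂` on `ℂ⁷`, respectively of `so_7` on
`ℂ⁸`, come in pairs `±w`; let `c₁, …, cₘ` be the `|w|`, one for each pair, so that now `m` is `3`,
respectively `4`. Then (`rhoQuot_vecG2`, `rhoQuot_vecSpin`)
`ρ_q - ρ_h = ∑ⱼ (2 ∑ᵢ max (cᵢ, tⱼ) - (2j + δ + m - 4) tⱼ) + δ ∑ᵢ cᵢ - L`,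
where `L = 3 ∑ |aᵢ|` for `g₂` and `L = 2 ∑_{i<j} max (|aᵢ|, |aⱼ|)` for `so_7`.

For `q ≤ m + 6` each summand over `j` is nonnegative, because `max (cᵢ, tⱼ) ≥ tⱼ`. This restriction
on `q` is necessary: for `a = 0` and `b = (1, 0, …, 0)` the difference is `m + 6 - q`. The summand
with `j = 0`, the summand with `j = 1` (if there is one) and the term with `δ` have to compensate
for `L`. This is possible because `L ≤ 2 ∑ cᵢ` for `g₂`, by the triangle inequality, and because
`L ≤ 3 ∑ cᵢ` for `so_7`. Both are equalities, for `a = (-1, -1, 2)` and `a = (1, 1, 0)`; with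
`b = 0` the difference is `6 q - 12`, respectively `2 q - 6`, at these points, which gives the lower
bounds on `q`. Following the cases of equality gives the witness vectors.
-/

namespace RhoIneq

/-! ### Additivity of `ρ` -/

section Additivity

variable {V W : Type*} [AddCommGroup V] [Module ℂ V] [Module.Finite ℂ V]
  [AddCommGroup W] [Module ℂ W] [Module.Finite ℂ W]

theorem rhoEnd_eq_of_basis {ι : Type*} [Fintype ι] (b : Module.Basis ι ℂ V) (T : Module.End ℂ V)
    (μ : ι → ℂ) (h : ∀ i, T (b i) = μ i • b i) : rhoEnd T = (1 / 2) * ∑ i, |(μ i).re| := by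
  classical
  have hT : LinearMap.toMatrix b b T = Matrix.diagonal μ := by
    ext i j
    rw [LinearMap.toMatrix_apply, h, map_smul, Module.Basis.repr_self, Finsupp.smul_apply,
      Finsupp.single_apply, Matrix.diagonal_apply]
    by_cases hij : i = j
    · subst hij; simp
    · simp [hij, Ne.symm hij]
  rw [rhoEnd, ← LinearMap.charpoly_toMatrix T b, hT, Matrix.charpoly_diagonal,
    Polynomial.roots_prod _ _ (Finset.prod_ne_zero_iff.2 fun i _ => Polynomial.X_sub_C_ne_zero _)]
  simp [Multiset.bind_singleton]

theorem rhoEnd_zero : rhoEnd (0 : Module.End ℂ V) = 0 := by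
  rw [rhoEnd_eq_of_basis (Module.finBasis ℂ V) 0 (fun _ => 0) (by simp)]
  simp

theorem rhoEnd_eq_of_intertwine (e : V ≃ₗ[ℂ] W) (T : Module.End ℂ V) (S : Module.End ℂ W)
    (h : ∀ x, e (T x) = S (e x)) : rhoEnd T = rhoEnd S := by
  have hS : S = e.conj T := by
    ext y
    simp [LinearEquiv.conj_apply, h]
  rw [rhoEnd, rhoEnd, hS, LinearEquiv.charpoly_conj]

theorem rhoEnd_prodMap (T : Module.End ℂ V) (S : Module.End ℂ W) :
    rhoEnd (T.prodMap S : Module.End ℂ (V × W)) = rhoEnd T + rhoEnd S := by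
  rw [rhoEnd, rhoEnd, rhoEnd, LinearMap.charpoly_prodMap, Polynomial.roots_mul
    (mul_ne_zero T.charpoly_monic.ne_zero S.charpoly_monic.ne_zero), Multiset.map_add,
    Multiset.sum_add, mul_add]

theorem charpoly_eq_restrict_mul_mapQ (U : Submodule ℂ V) (T : Module.End ℂ V)
    (hU : U ≤ U.comap T) :
    T.charpoly = (T.restrict hU).charpoly * (U.mapQ U T hU).charpoly := by
  refine Polynomial.funext fun t => ?_
  rw [Polynomial.eval_mul, LinearMap.eval_charpoly, LinearMap.eval_charpoly,
    LinearMap.eval_charpoly]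
  have hU' : U ≤ U.comap (algebraMap ℂ (Module.End ℂ V) t - T) := fun x hx =>
    U.sub_mem (by simpa using U.smul_mem t hx) (hU hx)
  rw [LinearMap.det_eq_det_mul_det U _ hU']
  congr 2
  ext
  rfl

/-- `ρ` is additive in short exact sequences: eigenvalues of an endomorphism are those on an
invariant subspace together with those on the quotient. -/
theorem rhoEnd_eq_restrict_add_mapQ (U : Submodule ℂ V) (T : Module.End ℂ V)
    (hU : U ≤ U.comap T) :
    rhoEnd T = rhoEnd (T.restrict hU) + rhoEnd (U.mapQ U T hU) := by
  rw [rhoEnd, rhoEnd, rhoEnd, charpoly_eq_restrict_mul_mapQ U T hU, Polynomial.roots_mul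
    (mul_ne_zero (LinearMap.charpoly_monic _).ne_zero (LinearMap.charpoly_monic _).ne_zero),
    Multiset.map_add, Multiset.sum_add, mul_add]

theorem rhoSub_add_rhoQuot {g : Type*} [LieRing g] [LieAlgebra ℂ g] [Module.Finite ℂ g]
    (h : LieSubalgebra ℂ g) (Y : h) :
    rhoSub h Y + rhoQuot h Y = rhoEnd (LieAlgebra.ad ℂ g (Y : g)) := by
  rw [rhoEnd_eq_restrict_add_mapQ h.toSubmodule (LieAlgebra.ad ℂ g (Y : g))
    (fun x hx => h.lie_mem Y.2 hx)]
  rfl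

theorem rhoSub_zero {g : Type*} [LieRing g] [LieAlgebra ℂ g] [Module.Finite ℂ g]
    (h : LieSubalgebra ℂ g) : rhoSub h 0 = 0 := by
  rw [rhoSub, map_zero, rhoEnd_zero]

end Additivity

/-! ### Eigenvalues on orthogonal Lie algebras -/

section Weights

variable {J K : Type*} [Fintype J] [Fintype K]

/-- The value of `ρ` on `Λ² ℂ^J` at a diagonal element with the real eigenvalues `w` on `ℂ^J`,
written as a sum over all pairs of indices instead of a sum over pairs `i < j`. -/
noncomputable def rhoWt (w : J → ℝ) : ℝ := (1 / 4) * (∑ i, ∑ j, |w i + w j| - 2 * ∑ i, |w i|)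

theorem rhoWt_eq_sum_lt [LinearOrder J] (w : J → ℝ) :
    (1 / 2) * ∑ p : {p : J × J // p.1 < p.2}, |w p.1.1 + w p.1.2| = rhoWt w := by
  have h1 : ∑ p : {p : J × J // p.1 < p.2}, |w p.1.1 + w p.1.2| =
      ∑ i, ∑ j, if i < j then |w i + w j| else 0 := by
    rw [← Fintype.sum_prod_type', ← Finset.sum_filter]
    exact (Finset.sum_subtype _ (by simp) (fun p : J × J => |w p.1 + w p.2|)).symm
  have h2 : ∑ i, ∑ j, |w i + w j| = (∑ i, ∑ j, if i < j then |w i + w j| else 0) +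
      (∑ i, ∑ j, if j < i then |w i + w j| else 0) + ∑ i, 2 * |w i| := by
    rw [← Finset.sum_add_distrib, ← Finset.sum_add_distrib]
    refine Finset.sum_congr rfl fun i _ => ?_
    have h3 : 2 * |w i| = ∑ j, if i = j then |w i + w j| else 0 := by
      rw [Finset.sum_ite_eq]
      simp [← two_mul, abs_mul]
    rw [h3, ← Finset.sum_add_distrib, ← Finset.sum_add_distrib]
    refine Finset.sum_congr rfl fun j _ => ?_
    rcases lt_trichotomy i j with h | h | h
    · simp [h, h.not_gt, h.ne]
    · simp [h]
    · simp [h, h.not_gt, h.ne']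
  have h4 : (∑ i, ∑ j, if j < i then |w i + w j| else 0) =
      ∑ i, ∑ j, if i < j then |w i + w j| else 0 := by
    rw [Finset.sum_comm]
    simp only [add_comm]
  rw [rhoWt, h2, h4, h1, ← Finset.mul_sum]
  ring

theorem rhoWt_sumElim (w : J → ℝ) (v : K → ℝ) :
    rhoWt (Sum.elim w v) = rhoWt w + rhoWt v + (1 / 2) * ∑ i, ∑ j, |w i + v j| := by
  have h : ∑ i, ∑ j, |v i + w j| = ∑ i, ∑ j, |w i + v j| := by
    rw [Finset.sum_comm]
    simp only [add_comm]
  simp only [rhoWt, Fintype.sum_sum_type, Sum.elim_inl, Sum.elim_inr, Finset.sum_add_distrib, h]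
  ring

end Weights

section Diagonalization

variable {n J : Type*} [Fintype n] [DecidableEq n] [Fintype J] [DecidableEq J]

/-- `A` is diagonalized by `P`, with inverse `Q`: the columns of `P` form a basis of eigenvectors
of `A`, with the real eigenvalues `w`. The index set `J` of the eigenvectors may differ from that of
the standard basis. -/
structure Diagonalizes (A : Matrix n n ℂ) (P : Matrix n J ℂ) (Q : Matrix J n ℂ) (w : J → ℝ) :
    Prop where
  mul_inv : P * Q = 1
  inv_mul : Q * P = 1
  eigen : A * P = P * Matrix.diagonal fun i => (w i : ℂ)

/-- Skew-symmetric matrices, as functions on the set of pairs `i < j`. Decidability of equality is a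
separate argument, so that it need not come from the order. -/
def soEquivFun (J : Type*) [Fintype J] [LinearOrder J] [DecidableEq J] :
    so J ℂ ≃ₗ[ℂ] ({p : J × J // p.1 < p.2} → ℂ) where
  toFun S p := S.1 p.1.1 p.1.2
  map_add' _ _ := rfl
  map_smul' _ _ := rfl
  invFun f := ⟨Matrix.of fun i j => if h : i < j then f ⟨(i, j), h⟩ else
      if h : j < i then - f ⟨(j, i), h⟩ else 0, by
    rw [mem_so]
    ext i j
    rcases lt_trichotomy i j with h | h | h
    · simp [h, h.not_gt]
    · simp [h]
    · simp [h, h.not_gt]⟩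
  left_inv S := by
    apply Subtype.ext
    ext i j
    have hS (i j : J) : S.1 j i = -S.1 i j := congrFun (congrFun ((mem_so _ _ _).1 S.2) i) j
    rcases lt_trichotomy i j with h | h | h
    · simp [h]
    · subst h
      have := hS i i
      simp only [Matrix.of_apply, lt_self_iff_false, dite_false]
      exact (self_eq_neg.1 this).symm
    · simp only [Matrix.of_apply, h, h.not_gt, dite_false, dite_true]
      rw [hS j i]
  right_inv f := by
    ext p
    simp [p.2]

/-- The change of basis `S ↦ Q S Qᵀ` on skew-symmetric matrices. -/
def soCongr (P : Matrix n J ℂ) (Q : Matrix J n ℂ) (hPQ : P * Q = 1) (hQP : Q * P = 1) :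
    so n ℂ ≃ₗ[ℂ] so J ℂ where
  toFun S := ⟨Q * S.1 * Q.transpose, by
    rw [mem_so]
    simp [Matrix.transpose_mul, (mem_so _ _ _).1 S.2, Matrix.mul_assoc]⟩
  invFun S := ⟨P * S.1 * P.transpose, by
    rw [mem_so]
    simp [Matrix.transpose_mul, (mem_so _ _ _).1 S.2, Matrix.mul_assoc]⟩
  map_add' S T := by
    apply Subtype.ext
    simp [Matrix.mul_add, Matrix.add_mul]
  map_smul' c S := by
    apply Subtype.ext
    simp
  left_inv S := by
    apply Subtype.ext
    change P * (Q * S.1 * Q.transpose) * P.transpose = S.1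
    calc _ = (P * Q) * S.1 * (P * Q).transpose := by
          simp only [Matrix.transpose_mul, Matrix.mul_assoc]
      _ = _ := by simp [hPQ]
  right_inv S := by
    apply Subtype.ext
    change Q * (P * S.1 * P.transpose) * Q.transpose = S.1
    calc _ = (Q * P) * S.1 * (Q * P).transpose := by
          simp only [Matrix.transpose_mul, Matrix.mul_assoc]
      _ = _ := by simp [hQP]

/-- The adjoint representation of `so_n` is `Λ² ℂⁿ`: its eigenvalues at a diagonalizable element
with eigenvalues `wᵢ` are the sums `wᵢ + wⱼ` for `i < j`. -/
theorem rhoEnd_ad_so {A : so n ℂ} {P : Matrix n J ℂ} {Q : Matrix J n ℂ} {w : J → ℝ}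
    (h : Diagonalizes A.1 P Q w) : rhoEnd (LieAlgebra.ad ℂ (so n ℂ) A) = rhoWt w := by
  -- An arbitrary order, to choose one out of each pair `(i, j)`, `(j, i)`.
  let _ : LinearOrder J := LinearOrder.lift' (Fintype.equivFin J) (Fintype.equivFin J).injective
  obtain ⟨hPQ, hQP, hA⟩ := h
  let e := (soCongr P Q hPQ hQP).trans (soEquivFun J)
  have hQA : Q * A.1 = Matrix.diagonal (fun i => (w i : ℂ)) * Q := by
    calc Q * A.1 = Q * (A.1 * P) * Q := by simp only [Matrix.mul_assoc, hPQ, Matrix.mul_one]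
      _ = _ := by rw [hA, ← Matrix.mul_assoc, hQP, Matrix.one_mul]
  have hAQ : A.1 * Q.transpose = -(Q.transpose * Matrix.diagonal fun i => (w i : ℂ)) := by
    have h1 := congrArg Matrix.transpose hQA
    rw [Matrix.transpose_mul, Matrix.transpose_mul, (mem_so _ _ _).1 A.2,
      Matrix.diagonal_transpose] at h1
    rw [← h1, Matrix.neg_mul, neg_neg]
  have key (S : so n ℂ) (p : {p : J × J // p.1 < p.2}) :
      e ⁅A, S⁆ p = ((w p.1.1 + w p.1.2 : ℝ) : ℂ) * e S p := by
    change (Q * (A.1 * S.1 - S.1 * A.1) * Q.transpose) p.1.1 p.1.2 =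
      _ * (Q * S.1 * Q.transpose) p.1.1 p.1.2
    have h2 : Q * (A.1 * S.1 - S.1 * A.1) * Q.transpose =
        Matrix.diagonal (fun i => (w i : ℂ)) * (Q * S.1 * Q.transpose) +
          (Q * S.1 * Q.transpose) * Matrix.diagonal (fun i => (w i : ℂ)) := by
      calc _ = (Q * A.1) * S.1 * Q.transpose - Q * S.1 * (A.1 * Q.transpose) := by
            simp only [Matrix.mul_sub, Matrix.sub_mul, Matrix.mul_assoc]
        _ = _ := by
            rw [hQA, hAQ]
            simp only [Matrix.mul_neg, sub_neg_eq_add, Matrix.mul_assoc]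
    rw [h2, Matrix.add_apply, Matrix.diagonal_mul, Matrix.mul_diagonal]
    push_cast
    ring
  rw [rhoEnd_eq_of_basis (Module.Basis.ofEquivFun e) _
    (fun p => ((w p.1.1 + w p.1.2 : ℝ) : ℂ)) fun p => ?_, ← rhoWt_eq_sum_lt]
  · simp only [Complex.ofReal_re]
  · apply e.injective
    ext p'
    rw [LieAlgebra.ad_apply, key, map_smul, Pi.smul_apply, smul_eq_mul,
      Module.Basis.coe_ofEquivFun, LinearEquiv.apply_symm_apply]
    by_cases hp : p' = p
    · rw [hp]
    · simp [hp]

/-- A block diagonal matrix is diagonalized by its blocks. -/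
theorem Diagonalizes.fromBlocks {n' J' : Type*} [Fintype n'] [DecidableEq n'] [Fintype J']
    [DecidableEq J'] {A : Matrix n n ℂ} {P : Matrix n J ℂ} {Q : Matrix J n ℂ} {w : J → ℝ}
    {A' : Matrix n' n' ℂ} {P' : Matrix n' J' ℂ} {Q' : Matrix J' n' ℂ} {w' : J' → ℝ}
    (h : Diagonalizes A P Q w) (h' : Diagonalizes A' P' Q' w') :
    Diagonalizes (Matrix.fromBlocks A 0 0 A') (Matrix.fromBlocks P 0 0 P')
      (Matrix.fromBlocks Q 0 0 Q') (Sum.elim w w') where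
  mul_inv := by simp [Matrix.fromBlocks_multiply, h.mul_inv, h'.mul_inv]
  inv_mul := by simp [Matrix.fromBlocks_multiply, h.inv_mul, h'.inv_mul]
  eigen := by
    have hd : (Matrix.diagonal fun i => ((Sum.elim w w' i : ℝ) : ℂ)) = Matrix.fromBlocks
        (Matrix.diagonal fun i => (w i : ℂ)) 0 0 (Matrix.diagonal fun i => (w' i : ℂ)) := by
      rw [Matrix.fromBlocks_diagonal]
      congr 1
      ext i
      cases i <;> rfl
    rw [hd, Matrix.fromBlocks_multiply, Matrix.fromBlocks_multiply]
    simp [h.eigen, h'.eigen]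

/-- Diagonalization is not affected by a renumbering of the standard basis. -/
theorem Diagonalizes.submatrix {n' : Type*} [Fintype n'] [DecidableEq n'] (e : n' ≃ n)
    {A : Matrix n' n' ℂ} {P : Matrix n J ℂ} {Q : Matrix J n ℂ} {w : J → ℝ}
    (h : Diagonalizes (A.submatrix e.symm e.symm) P Q w) :
    Diagonalizes A (P.submatrix e id) (Q.submatrix id e) w where
  mul_inv := by
    rw [← Matrix.submatrix_mul _ _ _ _ _ Function.bijective_id, h.mul_inv,
      Matrix.submatrix_one_equiv]
  inv_mul := by
    rw [Matrix.submatrix_mul_equiv, h.inv_mul, Matrix.submatrix_one _ Function.injective_id]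
  eigen := by
    have h1 := congrArg (fun M => M.submatrix e id) h.eigen
    rw [Matrix.submatrix_mul _ _ e e id e.bijective,
      Matrix.submatrix_mul _ _ e id id Function.bijective_id] at h1
    simpa using h1

end Diagonalization

/-! ### Eigenbases for the Cartan subalgebras -/

section Torus

/-- The two weights `±1` of a rotation of the plane. -/
def planeWt : Fin 2 → ℝ := ![1, -1]

/-- The generator of the complexified rotations of the plane, normalized to have the eigenvalues
`planeWt`. -/
def planeRot : Matrix (Fin 2) (Fin 2) ℂ := !![0, -Complex.I; Complex.I, 0]

/-- The eigenvectors of `planeRot`. -/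
def planeEig : Matrix (Fin 2) (Fin 2) ℂ := !![1, 1; Complex.I, -Complex.I]

/-- The inverse of `planeEig`. -/
noncomputable def planeEigInv : Matrix (Fin 2) (Fin 2) ℂ :=
  (1 / 2 : ℂ) • !![1, -Complex.I; 1, Complex.I]

theorem planeEig_mul_inv : planeEig * planeEigInv = 1 := by
  have hI := Complex.I_mul_I
  ext i j
  fin_cases i <;> fin_cases j <;> simp [planeEig, planeEigInv] <;>
    first
    | linear_combination (1 / 2 : ℂ) * hI
    | linear_combination (-1 / 2 : ℂ) * hI
    | linear_combination (-1 : ℂ) * hI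
    | ring

theorem planeEigInv_mul : planeEigInv * planeEig = 1 := by
  have hI := Complex.I_mul_I
  ext i j
  fin_cases i <;> fin_cases j <;> simp [planeEig, planeEigInv] <;>
    first
    | linear_combination (1 / 2 : ℂ) * hI
    | linear_combination (-1 / 2 : ℂ) * hI

theorem diagonalizes_plane (c : ℝ) :
    Diagonalizes ((c : ℂ) • planeRot) planeEig planeEigInv (fun s => c * planeWt s) where
  mul_inv := planeEig_mul_inv
  inv_mul := planeEigInv_mul
  eigen := by
    ext i j
    fin_cases i <;> fin_cases j <;> simp [planeEig, planeRot, planeWt] <;> ring_nf <;>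
      rw [Complex.I_sq] <;> ring

/-- On a tensor product of representations the eigenvalues add up. -/
theorem Diagonalizes.kronecker_add {n n' J J' : Type*} [Fintype n] [DecidableEq n] [Fintype n']
    [DecidableEq n'] [Fintype J] [DecidableEq J] [Fintype J'] [DecidableEq J']
    {A : Matrix n n ℂ} {P : Matrix n J ℂ} {Q : Matrix J n ℂ} {w : J → ℝ}
    {A' : Matrix n' n' ℂ} {P' : Matrix n' J' ℂ} {Q' : Matrix J' n' ℂ} {w' : J' → ℝ}
    (h : Diagonalizes A P Q w) (h' : Diagonalizes A' P' Q' w') :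
    Diagonalizes (A ⊗ₖ 1 + 1 ⊗ₖ A') (P ⊗ₖ P') (Q ⊗ₖ Q') (fun p => w p.1 + w' p.2) where
  mul_inv := by
    rw [← Matrix.mul_kronecker_mul, h.mul_inv, h'.mul_inv, Matrix.one_kronecker_one]
  inv_mul := by
    rw [← Matrix.mul_kronecker_mul, h.inv_mul, h'.inv_mul, Matrix.one_kronecker_one]
  eigen := by
    have hd : (Matrix.diagonal fun p : J × J' => ((w p.1 + w' p.2 : ℝ) : ℂ)) =
        (Matrix.diagonal fun i => (w i : ℂ)) ⊗ₖ 1 + 1 ⊗ₖ Matrix.diagonal fun i => (w' i : ℂ) := by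
      rw [← Matrix.diagonal_one, ← Matrix.diagonal_one, Matrix.diagonal_kronecker_diagonal,
        Matrix.diagonal_kronecker_diagonal, Matrix.diagonal_add]
      simp
    rw [hd, Matrix.add_mul, Matrix.mul_add, ← Matrix.mul_kronecker_mul, ← Matrix.mul_kronecker_mul,
      ← Matrix.mul_kronecker_mul, ← Matrix.mul_kronecker_mul, h.eigen, h'.eigen]
    simp only [Matrix.one_mul, Matrix.mul_one]

/-- Index set of an eigenbasis of the Cartan subalgebra of `so_q`: two eigenvectors for each of the
`⌊q/2⌋` planes, and one more if `q` is odd. -/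
abbrev TorusIdx (q : ℕ) : Type := (Fin (q / 2) × Fin 2) ⊕ Fin (q % 2)

/-- The numbering of the standard basis of `ℂ^q` that matches `soTorus`. -/
def torusEquiv (q : ℕ) : TorusIdx q ≃ Fin q :=
  (Equiv.sumCongr finProdFinEquiv (Equiv.refl _)).trans
    (finSumFinEquiv.trans (finCongr (Nat.div_add_mod' q 2)))

theorem torusEquiv_inl (q : ℕ) (k : Fin (q / 2)) (s : Fin 2) :
    (torusEquiv q (.inl (k, s)) : ℕ) = s + 2 * k := rfl

theorem torusEquiv_inr (q : ℕ) (z : Fin (q % 2)) :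
    (torusEquiv q (.inr z) : ℕ) = q / 2 * 2 + z := rfl

/-- The weights of `ℂ^q`: `±bₖ`, and `0` if `q` is odd. -/
def torusWt (q : ℕ) (b : Fin (q / 2) → ℝ) : TorusIdx q → ℝ :=
  Sum.elim (fun p => b p.1 * planeWt p.2) 0

/-- In the numbering `torusEquiv` an element of the Cartan subalgebra is block diagonal. -/
theorem soTorus_submatrix (q : ℕ) (b : Fin (q / 2) → ℝ) :
    (soTorus q b).1.submatrix (torusEquiv q) (torusEquiv q) =
      Matrix.fromBlocks ((Matrix.diagonal fun k => (b k : ℂ)) ⊗ₖ planeRot) 0 0 0 := by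
  have h (x y : Fin q) (m n : ℕ) (hm : (x : ℕ) = m) (hn : (y : ℕ) = n) :
      (soTorus q b).1 x y = ∑ k : Fin (q / 2), (-Complex.I * (b k : ℂ)) *
        ((if m = 2 * k then 1 else 0) * (if n = 2 * k + 1 then 1 else 0) -
          (if m = 2 * k + 1 then 1 else 0) * (if n = 2 * k then 1 else 0)) := by
    subst hm hn
    rw [soTorus, AddSubmonoidClass.coe_finsetSum, Matrix.sum_apply]
    refine Finset.sum_congr rfl fun k _ => ?_
    simp [wedge, Matrix.vecMulVec_apply, Pi.single_apply, Fin.ext_iff]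
  have h0 (x y : TorusIdx q) (hxy : x.isRight ∨ y.isRight) :
      (soTorus q b).1 (torusEquiv q x) (torusEquiv q y) = 0 := by
    rw [h _ _ _ _ rfl rfl]
    refine Finset.sum_eq_zero fun k _ => ?_
    have hk := k.2
    rcases x with ⟨i, s⟩ | i <;> rcases y with ⟨j, t⟩ | j
    · simp at hxy
    all_goals
      simp only [torusEquiv_inl, torusEquiv_inr]
      have h1 : ∀ z : Fin (q % 2), ¬ (q / 2 * 2 + (z : ℕ) = 2 * k) := fun z => by omega
      have h2 : ∀ z : Fin (q % 2), ¬ (q / 2 * 2 + (z : ℕ) = 2 * k + 1) := fun z => by omega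
      simp [h1, h2]
  ext x y
  rw [Matrix.submatrix_apply]
  rcases x with ⟨i, s⟩ | i
  · rcases y with ⟨j, t⟩ | j
    · rw [h _ _ _ _ (torusEquiv_inl q i s) (torusEquiv_inl q j t), Matrix.fromBlocks_apply₁₁,
        Matrix.kroneckerMap_apply, Finset.sum_eq_single i]
      · simp only [Matrix.diagonal_apply]
        by_cases hij : i = j
        · subst hij
          fin_cases s <;> fin_cases t <;> simp [planeRot, add_comm, mul_comm]
        · have h1 : ¬ ((t : ℕ) + 2 * j = 2 * i) := by have := t.2; omega
          have h2 : ¬ ((t : ℕ) + 2 * j = 2 * i + 1) := by have := t.2; omega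
          simp [h1, h2, hij]
      · intro k _ hk
        have hk' : (k : ℕ) ≠ i := fun h => hk (Fin.ext h)
        have h1 : ¬ ((s : ℕ) + 2 * i = 2 * k) := by have := s.2; omega
        have h2 : ¬ ((s : ℕ) + 2 * i = 2 * k + 1) := by have := s.2; omega
        simp [h1, h2]
      · simp
    · rw [h0 _ _ (by simp)]
      simp
  · rw [h0 _ _ (by simp)]
    rcases y with y | y <;> simp

theorem diagonalizes_soTorus (q : ℕ) (b : Fin (q / 2) → ℝ) :
    ∃ P Q, Diagonalizes (soTorus q b).1 P Q (torusWt q b) := by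
  have h1 : Diagonalizes ((Matrix.diagonal fun k => (b k : ℂ)) ⊗ₖ planeRot)
      ((1 : Matrix (Fin (q / 2)) (Fin (q / 2)) ℂ) ⊗ₖ planeEig) (1 ⊗ₖ planeEigInv)
      (fun p => b p.1 * planeWt p.2) :=
    { mul_inv := by
        rw [← Matrix.mul_kronecker_mul, planeEig_mul_inv, Matrix.mul_one, Matrix.one_kronecker_one]
      inv_mul := by
        rw [← Matrix.mul_kronecker_mul, planeEigInv_mul, Matrix.mul_one, Matrix.one_kronecker_one]
      eigen := by
        have hp := (diagonalizes_plane 1).eigen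
        simp only [Complex.ofReal_one, one_smul, one_mul] at hp
        have hd : (Matrix.diagonal fun p : Fin (q / 2) × Fin 2 =>
            ((b p.1 * planeWt p.2 : ℝ) : ℂ)) =
            (Matrix.diagonal fun k => (b k : ℂ)) ⊗ₖ Matrix.diagonal fun s => (planeWt s : ℂ) := by
          rw [Matrix.diagonal_kronecker_diagonal]
          simp
        rw [hd, ← Matrix.mul_kronecker_mul, ← Matrix.mul_kronecker_mul, hp, Matrix.mul_one,
          Matrix.one_mul] }
  have h2 : Diagonalizes (0 : Matrix (Fin (q % 2)) (Fin (q % 2)) ℂ) 1 1 0 :=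
    
    ⟨Matrix.one_mul _, Matrix.one_mul _, by ext; simp⟩
  have h3 := h1.fromBlocks h2
  rw [← soTorus_submatrix] at h3
  exact ⟨_, _, h3.submatrix (torusEquiv q).symm⟩

/-- The weights of the spin representation: all `(± a₁ ± a₂ ± a₃) / 2`. -/
noncomputable def spinWt (a : Fin 3 → ℝ) : I8 → ℝ := fun p =>
  -(a 2 / 2) * planeWt p.1 + (-(a 0 / 2) * planeWt p.2.1 + -(a 1 / 2) * planeWt p.2.2)

theorem soTorus_seven_apply (a : Fin 3 → ℝ) (M : Fin 7 → Fin 7 → Matrix I8 I8 ℂ) :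
    ∑ i, ∑ j, (soTorus 7 a).1 i j • M i j = ∑ k : Fin 3, (-Complex.I * (a k : ℂ)) •
      (M ⟨2 * k, by omega⟩ ⟨2 * k + 1, by omega⟩ - M ⟨2 * k + 1, by omega⟩ ⟨2 * k, by omega⟩) := by
  have h (i j : Fin 7) : (soTorus 7 a).1 i j = ∑ k : Fin 3, (-Complex.I * (a k : ℂ)) *
      ((if i = ⟨2 * k, by omega⟩ then 1 else 0) * (if j = ⟨2 * k + 1, by omega⟩ then 1 else 0) -
        (if i = ⟨2 * k + 1, by omega⟩ then 1 else 0) *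
          (if j = ⟨2 * k, by omega⟩ then 1 else 0)) := by
    rw [soTorus, AddSubmonoidClass.coe_finsetSum, Matrix.sum_apply]
    refine Finset.sum_congr rfl fun k _ => ?_
    simp [wedge, Matrix.vecMulVec_apply, Pi.single_apply]
  have hM (c d : Fin 7) :
      ∑ i, ∑ j, (if i = c then if j = d then M i j else 0 else 0) = M c d := by
    rw [Finset.sum_comm]
    simp
  simp only [h, Finset.sum_smul]
  rw [Finset.sum_congr rfl fun i _ => Finset.sum_comm, Finset.sum_comm]
  refine Finset.sum_congr rfl fun k _ => ?_
  simp only [mul_smul, ← Finset.smul_sum, sub_smul, Finset.sum_sub_distrib, ite_smul, one_smul,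
    zero_smul, hM]

/-- The products `γ₁γ₂`, `γ₃γ₄`, `γ₅γ₆` act on different tensor factors of `ℂ² ⊗ ℂ² ⊗ ℂ²`, each as
`planeRot` up to the factor `i`. -/
theorem spinMat_soTorus (a : Fin 3 → ℝ) : (spinRep (soTorus 7 a)).1 =
    (((-(a 2 / 2) : ℝ) : ℂ) • planeRot) ⊗ₖ 1 + 1 ⊗ₖ
      ((((-(a 0 / 2) : ℝ) : ℂ) • planeRot) ⊗ₖ 1 + 1 ⊗ₖ (((-(a 1 / 2) : ℝ) : ℂ) • planeRot)) := by
  have hR : planeRot = -Complex.I • mE := by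
    ext i j; fin_cases i <;> fin_cases j <;> simp [planeRot, mE]
  have ee : mE * mE = -1 := by ext a b; fin_cases a <;> fin_cases b <;> simp [mE]
  have st : mS * mT = -mE := by ext a b; fin_cases a <;> fin_cases b <;> simp [mE, mS, mT]
  have ts : mT * mS = mE := by ext a b; fin_cases a <;> fin_cases b <;> simp [mE, mS, mT]
  change spinMat (soTorus 7 a).1 = _
  rw [spinMat, soTorus_seven_apply, Fin.sum_univ_three, hR]
  simp [gamma, ← Matrix.mul_kronecker_mul, ee, st, ts, neg_kron, kron_neg, Matrix.kronecker_add,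
    Matrix.kronecker_smul, Matrix.smul_kronecker]
  module

theorem diagonalizes_spin (a : Fin 3 → ℝ) :
    ∃ P Q, Diagonalizes (spinRep (soTorus 7 a)).1 P Q (spinWt a) := by
  rw [spinMat_soTorus]
  exact ⟨_, _, (diagonalizes_plane _).kronecker_add
    ((diagonalizes_plane _).kronecker_add (diagonalizes_plane _))⟩

end Torus

/-! ### The subalgebras and their representations -/

section Pair

variable {k : Type*} [LieRing k] [LieAlgebra ℂ k] {m : Type*} [Fintype m] [DecidableEq m]

theorem blockDiag_injective {n : Type*} [Fintype n] [DecidableEq n] :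
    Function.Injective (blockDiag : so m ℂ × so n ℂ →ₗ⁅ℂ⁆ so (m ⊕ n) ℂ) := by
  rintro ⟨A, B⟩ ⟨A', B'⟩ h
  have h1 : Matrix.fromBlocks A.1 0 0 B.1 = Matrix.fromBlocks A'.1 0 0 B'.1 :=
    congrArg Subtype.val h
  rw [Matrix.fromBlocks_inj] at h1
  exact Prod.ext (Subtype.ext h1.1) (Subtype.ext h1.2.2.2)

/-- The image of `k ⊕ so_q` in `so_{m+q}`, as the product of the image of `k` and `so_q`. -/
noncomputable def pairRangeEquiv (π : k →ₗ⁅ℂ⁆ so m ℂ) (q : ℕ) :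
    (π.range × so (Fin q) ℂ) ≃ₗ[ℂ] (pairHom π q).range :=
  LinearEquiv.ofBijective
    { toFun := fun u => ⟨blockDiag (u.1.1, u.2), by
        obtain ⟨⟨_, x, rfl⟩, y⟩ := u
        exact ⟨(x, y), rfl⟩⟩
      map_add' := fun u v => Subtype.ext (map_add blockDiag (u.1.1, u.2) (v.1.1, v.2))
      map_smul' := fun c u => Subtype.ext (map_smul blockDiag c (u.1.1, u.2)) }
    ⟨fun u v h => by
      have h1 := blockDiag_injective (congrArg Subtype.val h)
      exact Prod.ext (Subtype.ext (congrArg Prod.fst h1)) (Prod.mk.inj h1).2,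
    fun z => by
      obtain ⟨_, ⟨x, y⟩, rfl⟩ := z
      exact ⟨(⟨π x, x, rfl⟩, y), rfl⟩⟩

/-- The adjoint representation of `h` splits according to its two summands. -/
theorem rhoSub_pairHom (π : k →ₗ⁅ℂ⁆ so m ℂ) (q : ℕ) (x : k) (y : so (Fin q) ℂ) :
    rhoSub (pairHom π q).range ((pairHom π q).rangeRestrict (x, y)) =
      rhoSub π.range (π.rangeRestrict x) + rhoEnd (LieAlgebra.ad ℂ (so (Fin q) ℂ) y) := by
  rw [rhoSub, rhoSub, ← rhoEnd_prodMap]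
  refine (rhoEnd_eq_of_intertwine (pairRangeEquiv π q) _ _ fun u => ?_).symm
  exact Subtype.ext (LieHom.map_lie blockDiag (π x, y) (u.1.1, u.2))

/-- `ρ_h` for the image `h` of an injective homomorphism. -/
theorem rhoSub_range_of_injective [Module.Finite ℂ k] {g : Type*} [LieRing g] [LieAlgebra ℂ g]
    [Module.Finite ℂ g] (π : k →ₗ⁅ℂ⁆ g) (hπ : Function.Injective π) (x : k) :
    rhoSub π.range (π.rangeRestrict x) = rhoEnd (LieAlgebra.ad ℂ k x) := by
  refine (rhoEnd_eq_of_intertwine (LinearEquiv.ofBijective (π.rangeRestrict : k →ₗ[ℂ] π.range)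
    ⟨fun u v h => hπ (congrArg Subtype.val h), π.surjective_rangeRestrict⟩) _ _ fun u => ?_).symm
  exact Subtype.ext (π.map_lie x u)

/-- `ρ_h + ρ_q = ρ_g` at an element whose first component has the weights `w` on `ℂ^m`: the roots of
`so_{m+q}` are those of the two blocks and the sums of a weight of each block. -/
theorem rhoSub_add_rhoQuot_pairHom {J : Type*} [Fintype J] [DecidableEq J]
    (π : k →ₗ⁅ℂ⁆ so m ℂ) (q : ℕ) (x : k) (b : Fin (q / 2) → ℝ) {P : Matrix m J ℂ}
    {Q : Matrix J m ℂ} {w : J → ℝ} (h : Diagonalizes (π x).1 P Q w) :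
    rhoSub (pairHom π q).range ((pairHom π q).rangeRestrict (x, soTorus q b)) +
      rhoQuot (pairHom π q).range ((pairHom π q).rangeRestrict (x, soTorus q b)) =
      rhoWt w + rhoWt (torusWt q b) + (1 / 2) * ∑ i, ∑ j, |w i + torusWt q b j| := by
  obtain ⟨P', Q', h'⟩ := diagonalizes_soTorus q b
  rw [rhoSub_add_rhoQuot, ← rhoWt_sumElim]
  exact rhoEnd_ad_so (h.fromBlocks h')

end Pair

section Spin

/-- The spin representation is faithful: `A` can be recovered from the commutators of its image
with the matrices `γₖ`, since these are linearly independent. -/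
theorem spinRep_injective : Function.Injective spinRep := by
  rw [injective_iff_map_eq_zero]
  intro A hA
  have hA' : spinMat A.1 = 0 := congrArg Subtype.val hA
  apply Subtype.ext
  ext j k
  have h1 : ∑ i, A.1 i k • gamma i = 0 := by
    rw [← spinMat_gamma A.1 ((mem_so _ _ _).1 A.2) k, hA', zero_mul, mul_zero, sub_zero]
  have h2 : ∑ i, A.1 i k • (gamma i * gamma j + gamma j * gamma i) = 0 := by
    have h3 : (∑ i, A.1 i k • gamma i) * gamma j + gamma j * (∑ i, A.1 i k • gamma i) = 0 := by
      rw [h1, zero_mul, mul_zero, add_zero]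
    rw [Finset.sum_mul, Finset.mul_sum, ← Finset.sum_add_distrib] at h3
    simpa only [smul_mul_assoc, mul_smul_comm, ← smul_add] using h3
  simp only [gamma_anticomm, smul_ite, smul_zero, Finset.sum_ite_eq', Finset.mem_univ,
    if_true] at h2
  have h4 := congrFun (congrFun h2 0) 0
  have h5 : (-2 : Matrix I8 I8 ℂ) 0 0 = -2 := by
    change -((OfNat.ofNat 2 : Matrix I8 I8 ℂ) 0 0) = -2
    rw [Matrix.ofNat_apply, if_pos rfl]
    rfl
  rw [Matrix.smul_apply, h5] at h4
  simpa using h4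

end Spin

section G2

open CartanMatrix

/-- The pairing `A ↦ xᵀ A y` with skew-symmetric matrices. -/
def soPairing {n : Type*} [Fintype n] [DecidableEq n] (x y : n → ℂ) : so n ℂ →ₗ[ℂ] ℂ where
  toFun A := x ⬝ᵥ A.1.mulVec y
  map_add' A B := by simp [Matrix.add_mulVec]
  map_smul' c A := by simp [Matrix.smul_mulVec]

theorem soPairing_wedge {n : Type*} [Fintype n] [DecidableEq n] (x y u v : n → ℂ) :
    soPairing x y (wedge u v) = (x ⬝ᵥ u) * (v ⬝ᵥ y) - (x ⬝ᵥ v) * (u ⬝ᵥ y) := by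
  change x ⬝ᵥ (Matrix.vecMulVec u v - Matrix.vecMulVec v u).mulVec y = _
  simp [Matrix.sub_mulVec, Matrix.vecMulVec_mulVec, mul_comm]

/-- A basis of the image of `g₂` in `so_7`: the coroots `H 0`, `H 1`, then root vectors for the
positive roots `α₁, α₂, α₁ + α₂, 2α₁ + α₂, 3α₁ + α₂, 3α₁ + 2α₂` and for their negatives. -/
noncomputable def g2Vec : Fin 14 → so (Fin 7) ℂ :=
  ![g2Gen (.H 0), g2Gen (.H 1), g2Gen (.E 0), g2Gen (.E 1),
    (1 / 2 : ℂ) • wedge (wtPos 0) (wtNeg 2) - wedge (wtPos 1) wtZero,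
    wedge (wtPos 1) (wtPos 2) + (2 : ℂ) • wedge (wtPos 0) wtZero,
    wedge (wtPos 0) (wtPos 2), wedge (wtPos 0) (wtPos 1),
    g2Gen (.F 0), g2Gen (.F 1),
    (1 / 2 : ℂ) • wedge (wtPos 2) (wtNeg 0) + wedge (wtNeg 1) wtZero,
    wedge (wtNeg 1) (wtNeg 2) + (2 : ℂ) • wedge (wtNeg 0) wtZero,
    wedge (wtNeg 0) (wtNeg 2), wedge (wtNeg 0) (wtNeg 1)]

/-- A Chevalley generator maps each vector of the basis `g2Vec` to the multiple by this number of
the vector with the number `g2AdIdx`. -/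
noncomputable def g2AdCoeff : Generators (Fin 2) → Fin 14 → ℂ
  | .H 0 => ![0, 0, 2, -3, -1, 1, 3, 0, -2, 3, 1, -1, -3, 0]
  | .H 1 => ![0, 0, -1, 2, 1, 0, -1, 1, 1, -2, -1, 0, 1, -1]
  | .E 0 => ![-2, 1, 0, 1, -1, 3, 0, 0, 1, 0, -3, -4, -1, 0]
  | .E 1 => ![3, -2, -1, 0, 0, 0, 1, 0, 0, 1, 1, 0, 0, -1]
  | .F 0 => ![2, -1, -1, 0, 3, -4, 1, 0, 0, -1, -1, -3, 0, 0]
  | .F 1 => ![-3, 2, 0, -1, -1, 0, 0, 1, 1, 0, 0, 0, -1, 0]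

/-- The number of the basis vector to which a Chevalley generator maps a basis vector, up to the
factor `g2AdCoeff` (arbitrary if that factor vanishes). -/
def g2AdIdx : Generators (Fin 2) → Fin 14 → Fin 14
  | .H _ => id
  | .E 0 => ![2, 2, 0, 4, 5, 6, 0, 0, 0, 0, 9, 10, 11, 0]
  | .E 1 => ![3, 3, 4, 0, 0, 0, 7, 0, 0, 1, 8, 0, 0, 12]
  | .F 0 => ![8, 8, 0, 0, 3, 4, 5, 0, 0, 10, 11, 12, 0, 0]
  | .F 1 => ![9, 9, 0, 1, 2, 0, 0, 6, 10, 0, 0, 0, 13, 0]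

set_option maxHeartbeats 4000000 in
-- The proof checks 84 brackets.
theorem g2Gen_lie_g2Vec (x : Generators (Fin 2)) (i : Fin 14) :
    ⁅g2Gen x, g2Vec i⁆ = g2AdCoeff x i • g2Vec (g2AdIdx x i) := by
  have s1 (a b : Fin 3) : wedge (wtNeg a) (wtPos b) = -wedge (wtPos b) (wtNeg a) :=
    wedge_swap _ _
  have s2 (u : Fin 7 → ℂ) : wedge wtZero u = -wedge u wtZero := wedge_swap _ _
  have s3 : wedge (wtPos 1) (wtPos 0) = -wedge (wtPos 0) (wtPos 1) := wedge_swap _ _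
  have s4 : wedge (wtPos 2) (wtPos 0) = -wedge (wtPos 0) (wtPos 2) := wedge_swap _ _
  have s5 : wedge (wtPos 2) (wtPos 1) = -wedge (wtPos 1) (wtPos 2) := wedge_swap _ _
  have s6 : wedge (wtNeg 1) (wtNeg 0) = -wedge (wtNeg 0) (wtNeg 1) := wedge_swap _ _
  have s7 : wedge (wtNeg 2) (wtNeg 0) = -wedge (wtNeg 0) (wtNeg 2) := wedge_swap _ _
  have s8 : wedge (wtNeg 2) (wtNeg 1) = -wedge (wtNeg 1) (wtNeg 2) := wedge_swap _ _
  rcases x with x | x | x <;> fin_cases x <;> fin_cases i <;>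
    simp [g2Vec, g2Gen, g2AdCoeff, g2AdIdx, wedge_lie, dot_pos_pos, dot_neg_neg, dot_pos_neg,
      dot_neg_pos, dot_pos_zero, dot_neg_zero, dot_zero_pos, dot_zero_neg, dot_zero_zero,
      wedge_self, s1, s2, s3, s4, s5, s6, s7, s8] <;>
    module

end G2

/-! ### The image of `g₂` in `so_7` -/

section G2

open CartanMatrix

/-- For each root vector of the family there is a pairing with two weight vectors that vanishes on
the rest of the family; the same holds for one coroot, and for the other one up to the first. -/
theorem linearIndependent_g2Vec : LinearIndependent ℂ g2Vec := by
  rw [Fintype.linearIndependent_iff]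
  intro c hc
  have key (x y : Fin 7 → ℂ) : ∑ i, c i * soPairing x y (g2Vec i) = 0 := by
    have h := congrArg (soPairing x y) hc
    simpa using h
  simp only [Fin.sum_univ_succ, g2Vec, g2Gen, Matrix.cons_val_zero, Matrix.cons_val_succ,
    map_add, map_sub, map_smul, soPairing_wedge, smul_eq_mul, Fin.sum_univ_zero] at key
  have k0 := key (wtNeg 0) (wtPos 0)
  have k1 := key (wtNeg 1) (wtPos 1)
  have k2 := key (wtNeg 0) (wtPos 1)
  have k3 := key (wtNeg 1) (wtPos 2)
  have k4 := key (wtNeg 0) (wtPos 2)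
  have k5 := key (wtNeg 0) wtZero
  have k6 := key (wtNeg 0) (wtNeg 2)
  have k7 := key (wtNeg 0) (wtNeg 1)
  have k8 := key (wtNeg 1) (wtPos 0)
  have k9 := key (wtNeg 2) (wtPos 1)
  have k10 := key (wtNeg 2) (wtPos 0)
  have k11 := key (wtPos 0) wtZero
  have k12 := key (wtPos 0) (wtPos 2)
  have k13 := key (wtPos 0) (wtPos 1)
  clear key
  simp [dot_pos_pos, dot_neg_neg, dot_pos_neg, dot_neg_pos, dot_pos_zero, dot_neg_zero,
    dot_zero_pos, dot_zero_neg, dot_zero_zero] at k0 k1 k2 k3 k4 k5 k6 k7 k8 k9 k10 k11 k12 k13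
  rw [k0] at k1
  intro i
  fin_cases i <;> simp_all

theorem g2Gen_mem_range (x : Generators (Fin 2)) : g2Gen x ∈ g2Rep.range :=
  ⟨LieSubmodule.Quotient.mk (N := Relations.toIdeal ℂ G₂) (FreeLieAlgebra.of ℂ x),
    FreeLieAlgebra.lift_of_apply (R := ℂ) g2Gen x⟩

/-- Each root vector is obtained from one of smaller height by bracketing with a generator. -/
theorem g2Vec_mem_range (i : Fin 14) : g2Vec i ∈ g2Rep.range := by
  have step (x : Generators (Fin 2)) (i : Fin 14) (hi : g2Vec i ∈ g2Rep.range)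
      (hc : g2AdCoeff x i ≠ 0) : g2Vec (g2AdIdx x i) ∈ g2Rep.range := by
    have h := g2Rep.range.smul_mem (g2AdCoeff x i)⁻¹ (g2Rep.range.lie_mem (g2Gen_mem_range x) hi)
    rwa [g2Gen_lie_g2Vec, inv_smul_smul₀ hc] at h
  have h4 : g2Vec 4 ∈ g2Rep.range :=
    step (.E 0) 3 (g2Gen_mem_range (.E 1)) (by simp [g2AdCoeff])
  have h5 : g2Vec 5 ∈ g2Rep.range := step (.E 0) 4 h4 (by simp [g2AdCoeff])
  have h6 : g2Vec 6 ∈ g2Rep.range := step (.E 0) 5 h5 (by simp [g2AdCoeff])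
  have h7 : g2Vec 7 ∈ g2Rep.range := step (.E 1) 6 h6 (by simp [g2AdCoeff])
  have h10 : g2Vec 10 ∈ g2Rep.range :=
    step (.F 0) 9 (g2Gen_mem_range (.F 1)) (by simp [g2AdCoeff])
  have h11 : g2Vec 11 ∈ g2Rep.range := step (.F 0) 10 h10 (by simp [g2AdCoeff])
  have h12 : g2Vec 12 ∈ g2Rep.range := step (.F 0) 11 h11 (by simp [g2AdCoeff])
  have h13 : g2Vec 13 ∈ g2Rep.range := step (.F 1) 12 h12 (by simp [g2AdCoeff])
  fin_cases i
  exacts [g2Gen_mem_range (.H 0), g2Gen_mem_range (.H 1), g2Gen_mem_range (.E 0),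
    g2Gen_mem_range (.E 1), h4, h5, h6, h7, g2Gen_mem_range (.F 0), g2Gen_mem_range (.F 1),
    h10, h11, h12, h13]

theorem freeLieAlgebra_lift_mem {X L : Type*} [LieRing L] [LieAlgebra ℂ L] (f : X → L)
    (N : LieSubalgebra ℂ L) (h : ∀ x, f x ∈ N) (y : FreeLieAlgebra ℂ X) :
    FreeLieAlgebra.lift ℂ f y ∈ N := by
  have h1 : FreeLieAlgebra.lift ℂ f =
      N.incl.comp (FreeLieAlgebra.lift ℂ fun x => (⟨f x, h x⟩ : N)) := by
    ext x
    simp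
  rw [h1]
  exact Subtype.property _

/-- Let a subspace `W` contain the values of `f` and be stable under bracketing with them. Then it
contains the subalgebra that they generate. -/
theorem freeLieAlgebra_lift_mem_of_stable {X L : Type*} [LieRing L] [LieAlgebra ℂ L] (f : X → L)
    (W : Submodule ℂ L) (h : ∀ x, f x ∈ W) (h' : ∀ x, ∀ z ∈ W, ⁅f x, z⁆ ∈ W)
    (y : FreeLieAlgebra ℂ X) : FreeLieAlgebra.lift ℂ f y ∈ W := by
  -- The elements of `W` that stabilize `W` form a subalgebra.
  let N : LieSubalgebra ℂ L :=
    { carrier := {u | u ∈ W ∧ ∀ z ∈ W, ⁅u, z⁆ ∈ W}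
      add_mem' := fun {u v} hu hv => ⟨W.add_mem hu.1 hv.1, fun z hz => by
        rw [add_lie]
        exact W.add_mem (hu.2 z hz) (hv.2 z hz)⟩
      zero_mem' := ⟨W.zero_mem, fun z _ => by simp⟩
      smul_mem' := fun c u hu => ⟨W.smul_mem c hu.1, fun z hz => by
        rw [smul_lie]
        exact W.smul_mem c (hu.2 z hz)⟩
      lie_mem' := fun {u v} hu hv => ⟨hu.2 v hv.1, fun z hz => by
        rw [lie_lie]
        exact W.sub_mem (hu.2 _ (hv.2 z hz)) (hv.2 _ (hu.2 z hz))⟩ }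
  exact (freeLieAlgebra_lift_mem f N (fun x => ⟨h x, h' x⟩) y).1

theorem g2Rep_range_le_span (A : so (Fin 7) ℂ) (hA : A ∈ g2Rep.range) :
    A ∈ Submodule.span ℂ (Set.range g2Vec) := by
  obtain ⟨⟨y⟩, rfl⟩ := hA
  refine freeLieAlgebra_lift_mem_of_stable g2Gen _ (fun x => ?_) (fun x z hz => ?_) y
  · rcases x with x | x | x <;> fin_cases x
    exacts [Submodule.subset_span ⟨0, rfl⟩, Submodule.subset_span ⟨1, rfl⟩,
      Submodule.subset_span ⟨2, rfl⟩, Submodule.subset_span ⟨3, rfl⟩,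
      Submodule.subset_span ⟨8, rfl⟩, Submodule.subset_span ⟨9, rfl⟩]
  · induction hz using Submodule.span_induction with
    | mem z hz =>
      obtain ⟨i, rfl⟩ := hz
      rw [g2Gen_lie_g2Vec]
      exact Submodule.smul_mem _ _ (Submodule.subset_span ⟨_, rfl⟩)
    | zero => simp
    | add u v _ _ hu hv =>
      rw [lie_add]
      exact Submodule.add_mem _ hu hv
    | smul c u _ hu =>
      rw [lie_smul]
      exact Submodule.smul_mem _ c hu

/-- The vectors `g2Vec` as a basis of the image of `g₂`. -/
noncomputable def g2Basis : Module.Basis (Fin 14) ℂ g2Rep.range :=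
  Module.Basis.mk (v := fun i => (⟨g2Vec i, g2Vec_mem_range i⟩ : g2Rep.range))
    (LinearIndependent.of_comp g2Rep.range.toSubmodule.subtype linearIndependent_g2Vec)
    (by
      rintro ⟨A, hA⟩ -
      have h := g2Rep_range_le_span A hA
      have h1 : Set.range g2Vec = g2Rep.range.toSubmodule.subtype ''
          Set.range fun i => (⟨g2Vec i, g2Vec_mem_range i⟩ : g2Rep.range) := by
        rw [← Set.range_comp]
        rfl
      rw [h1, ← Submodule.map_span] at h
      obtain ⟨B, hB, hBA⟩ := h
      have h2 : B = ⟨A, hA⟩ := Subtype.ext hBA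
      exact h2 ▸ hB)

theorem g2Rep_g2Torus (a : Fin 3 → ℝ) : g2Rep (g2Torus a) =
    ((a 2 - a 1 : ℝ) : ℂ) • g2Gen (.H 0) + ((3 * a 2 : ℝ) : ℂ) • g2Gen (.H 1) := by
  rw [g2Torus, map_add, map_smul, map_smul, g2Rep_g2H, g2Rep_g2H]

/-- The weights of the seven-dimensional representation of `g₂` are `±` these numbers and `0`. -/
def g2Wt (a : Fin 3 → ℝ) : Fin 3 → ℝ := ![a 2 - a 1, a 2 - a 0, a 0 - a 1]

/-- The Cartan subalgebra of `g₂` lies in that of `so_7`. -/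
theorem g2Rep_g2Torus_eq_soTorus {a : Fin 3 → ℝ} (ha : a ∈ g2Split) :
    g2Rep (g2Torus a) = soTorus 7 (g2Wt a) := by
  have hw (k : Fin 3) : wedge (wtPos k) (wtNeg k) = (-2 * Complex.I) •
      wedge (Pi.single (⟨2 * k, by omega⟩ : Fin 7) 1) (Pi.single ⟨2 * k + 1, by omega⟩ 1) := by
    apply Subtype.ext
    ext i j
    simp [wedge, wtPos, wtNeg, Matrix.vecMulVec_apply]
    ring
  have h2 : a 2 = -a 0 - a 1 := by
    have h := ha
    simp only [g2Split, Set.mem_ofPred_eq] at h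
    linarith
  rw [g2Rep_g2Torus]
  change _ = ∑ k : Fin 3, (-Complex.I * (g2Wt a k : ℂ)) •
      wedge (Pi.single (⟨2 * k, by omega⟩ : Fin 7) 1) (Pi.single ⟨2 * k + 1, by omega⟩ 1)
  rw [Fin.sum_univ_three]
  simp only [g2Gen, hw, g2Wt, Matrix.cons_val, h2]
  push_cast
  module

/-- The sum of the positive roots of `g₂`, in absolute value: the short ones are the weights of the
seven-dimensional representation, the long ones are `3 aᵢ` up to sign. -/
theorem rhoSub_g2 {a : Fin 3 → ℝ} (ha : a ∈ g2Split) :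
    rhoSub g2Rep.range (g2Rep.rangeRestrict (g2Torus a)) =
      |a 2 - a 1| + |a 2 - a 0| + |a 0 - a 1| + 3 * (|a 0| + |a 1| + |a 2|) := by
  have h2 : a 2 = -a 0 - a 1 := by
    have h := ha
    simp only [g2Split, Set.mem_ofPred_eq] at h
    linarith
  have h (i : Fin 14) : LieModule.toEnd ℂ g2Rep.range g2Rep.range
      (g2Rep.rangeRestrict (g2Torus a)) (g2Basis i) =
      ((a 2 - a 1 : ℝ) * g2AdCoeff (.H 0) i + (3 * a 2 : ℝ) * g2AdCoeff (.H 1) i : ℂ) •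
        g2Basis i := by
    apply Subtype.ext
    rw [g2Basis, Module.Basis.mk_apply]
    change ⁅g2Rep (g2Torus a), g2Vec i⁆ = _ • g2Vec i
    have h0 := g2Gen_lie_g2Vec (.H 0) i
    have h1 := g2Gen_lie_g2Vec (.H 1) i
    simp only [g2AdIdx, id] at h0 h1
    rw [g2Rep_g2Torus, add_lie, smul_lie, smul_lie, h0, h1]
    module
  have a3 (x : ℝ) : |3 * x| = 3 * |x| := by rw [abs_mul, abs_of_pos (by norm_num : (0 : ℝ) < 3)]
  rw [rhoSub, rhoEnd_eq_of_basis g2Basis _ _ h]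
  have e1 : (a 2 - a 1) * 2 + -(3 * a 2) = a 0 - a 1 := by linarith
  have e2 : -((a 2 - a 1) * 3) + 3 * a 2 * 2 = -(3 * a 0) := by linarith
  have e3 : a 1 - a 2 + 3 * a 2 = a 2 - a 0 := by linarith
  have e4 : (a 2 - a 1) * 3 + -(3 * a 2) = -(3 * a 1) := by linarith
  have e5 : -((a 2 - a 1) * 2) + 3 * a 2 = -(a 0 - a 1) := by linarith
  have e6 : (a 2 - a 1) * 3 + -(3 * a 2 * 2) = 3 * a 0 := by linarith
  have e7 : a 2 - a 1 + -(3 * a 2) = -(a 2 - a 0) := by linarith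
  have e8 : -((a 2 - a 1) * 3) + 3 * a 2 = 3 * a 1 := by linarith
  simp [g2AdCoeff, Fin.sum_univ_succ]
  rw [e1, e2, e3, e4, e5, e6, e7, e8, abs_sub_comm (a 1) (a 2)]
  simp only [abs_neg, a3]
  ring

theorem diagonalizes_g2 {a : Fin 3 → ℝ} (ha : a ∈ g2Split) :
    ∃ P Q, Diagonalizes (g2Rep (g2Torus a)).1 P Q (torusWt 7 (g2Wt a)) := by
  rw [g2Rep_g2Torus_eq_soTorus ha]
  exact diagonalizes_soTorus 7 (g2Wt a)

end G2

/-! ### Weight formulas -/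

section Formulas

theorem abs_add_add_abs_sub (x y : ℝ) : |x + y| + |x - y| = 2 * max |x| |y| := by
  rcases le_total |x| |y| with h | h
  · rw [max_eq_right h]
    have h1 := abs_le.1 h
    rcases abs_cases y with ⟨hy, _⟩ | ⟨hy, _⟩ <;> rw [hy] at h1 ⊢
    · rw [abs_of_nonneg (by linarith), abs_of_nonpos (by linarith)]
      ring
    · rw [abs_of_nonpos (by linarith), abs_of_nonneg (by linarith)]
      ring
  · rw [max_eq_left h]
    have h1 := abs_le.1 h
    rcases abs_cases x with ⟨hx, _⟩ | ⟨hx, _⟩ <;> rw [hx] at h1 ⊢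
    · rw [abs_of_nonneg (by linarith), abs_of_nonneg (by linarith)]
      ring
    · rw [abs_of_nonpos (by linarith), abs_of_nonpos (by linarith)]
      ring

theorem sum_torusWt (q : ℕ) (b : Fin (q / 2) → ℝ) (f : ℝ → ℝ) :
    ∑ j, f (torusWt q b j) = ∑ k, (f (b k) + f (-b k)) + ((q % 2 : ℕ) : ℝ) * f 0 := by
  simp [torusWt, Fintype.sum_prod_type, planeWt]

theorem sum_abs_add_torusWt (q : ℕ) (b : Fin (q / 2) → ℝ) (x : ℝ) :
    ∑ j, |x + torusWt q b j| = ∑ k, 2 * max |x| |b k| + ((q % 2 : ℕ) : ℝ) * |x| := by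
  rw [sum_torusWt q b fun y => |x + y|]
  simp only [← sub_eq_add_neg, abs_add_add_abs_sub, add_zero]

/-- `ρ` of `so_q`. For odd `q` the coefficient of the second sum vanishes. -/
theorem rhoWt_torusWt (q : ℕ) (b : Fin (q / 2) → ℝ) :
    rhoWt (torusWt q b) =
      ∑ i, ∑ j, max |b i| |b j| + (((q % 2 : ℕ) : ℝ) - 1) * ∑ i, |b i| := by
  have h (x : ℝ) : max 0 |x| = |x| := max_eq_right (abs_nonneg x)
  rw [rhoWt]
  simp only [sum_abs_add_torusWt]
  rw [sum_torusWt q b fun y => ∑ k, 2 * max |y| |b k| + ((q % 2 : ℕ) : ℝ) * |y|,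
    sum_torusWt q b fun y => |y|]
  simp only [abs_neg, abs_zero, mul_zero, add_zero, Finset.sum_add_distrib, ← Finset.mul_sum,
    h]
  ring

/-- One weight of the spin representation out of each pair `±w`. -/
noncomputable def spinHalfWt (a : Fin 3 → ℝ) : Fin 4 → ℝ :=
  ![(a 0 + a 1 + a 2) / 2, (a 0 + a 1 - a 2) / 2, (a 0 - a 1 + a 2) / 2, (a 0 - a 1 - a 2) / 2]

theorem sum_spinWt (a : Fin 3 → ℝ) (f : ℝ → ℝ) :
    ∑ p, f (spinWt a p) = ∑ k, (f (spinHalfWt a k) + f (-spinHalfWt a k)) := by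
  simp only [Fintype.sum_prod_type, Fin.sum_univ_two, Fin.sum_univ_four, spinWt, planeWt,
    spinHalfWt, Matrix.cons_val]
  ring_nf

theorem sum_abs_add_spinWt (a : Fin 3 → ℝ) (x : ℝ) :
    ∑ p, |x + spinWt a p| = ∑ k, 2 * max |x| |spinHalfWt a k| := by
  rw [sum_spinWt a fun y => |x + y|]
  simp only [← sub_eq_add_neg, abs_add_add_abs_sub]

/-- Under the spin representation `so_8` is the sum of the adjoint and the seven-dimensional
representation of `so_7`. -/
theorem rhoWt_spinWt (a : Fin 3 → ℝ) :
    rhoWt (spinWt a) = rhoWt (torusWt 7 a) + ∑ i, |a i| := by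
  have hs : rhoWt (spinWt a) = ∑ k, ∑ l, max |spinHalfWt a k| |spinHalfWt a l| -
      ∑ k, |spinHalfWt a k| := by
    rw [rhoWt]
    simp only [sum_abs_add_spinWt]
    rw [sum_spinWt a fun y => ∑ k, 2 * max |y| |spinHalfWt a k|, sum_spinWt a fun y => |y|]
    simp only [abs_neg, Finset.sum_add_distrib, ← Finset.mul_sum]
    ring
  have hmax (x y : ℝ) : max |x| |y| = (|x + y| + |x - y|) / 2 := by
    rw [abs_add_add_abs_sub]
    ring
  rw [hs, rhoWt_torusWt]
  have e1 : (a 0 + a 1 + a 2) / 2 + (a 0 + a 1 - a 2) / 2 = a 0 + a 1 := by ring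
  have e2 : (a 0 + a 1 + a 2) / 2 - (a 0 + a 1 - a 2) / 2 = a 2 := by ring
  have e3 : (a 0 + a 1 + a 2) / 2 + (a 0 - a 1 + a 2) / 2 = a 0 + a 2 := by ring
  have e4 : (a 0 + a 1 + a 2) / 2 - (a 0 - a 1 + a 2) / 2 = a 1 := by ring
  have e5 : (a 0 + a 1 + a 2) / 2 + (a 0 - a 1 - a 2) / 2 = a 0 := by ring
  have e6 : (a 0 + a 1 + a 2) / 2 - (a 0 - a 1 - a 2) / 2 = a 1 + a 2 := by ring
  have e7 : (a 0 + a 1 - a 2) / 2 + (a 0 - a 1 + a 2) / 2 = a 0 := by ring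
  have e8 : (a 0 + a 1 - a 2) / 2 - (a 0 - a 1 + a 2) / 2 = a 1 - a 2 := by ring
  have e9 : (a 0 + a 1 - a 2) / 2 + (a 0 - a 1 - a 2) / 2 = a 0 - a 2 := by ring
  have e10 : (a 0 + a 1 - a 2) / 2 - (a 0 - a 1 - a 2) / 2 = a 1 := by ring
  have e11 : (a 0 - a 1 + a 2) / 2 + (a 0 - a 1 - a 2) / 2 = a 0 - a 1 := by ring
  have e12 : (a 0 - a 1 + a 2) / 2 - (a 0 - a 1 - a 2) / 2 = a 2 := by ring
  change _ = ∑ i : Fin 3, ∑ j : Fin 3, max |a i| |a j| + (((1 : ℕ) : ℝ) - 1) * ∑ i : Fin 3, |a i| +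
    ∑ i : Fin 3, |a i|
  simp only [Fin.sum_univ_three, Fin.sum_univ_four, spinHalfWt, Matrix.cons_val, max_self,
    max_comm ((|(a 0 + a 1 - a 2) / 2|)) (|(a 0 + a 1 + a 2) / 2|),
    max_comm ((|(a 0 - a 1 + a 2) / 2|)) (|(a 0 + a 1 + a 2) / 2|),
    max_comm ((|(a 0 - a 1 - a 2) / 2|)) (|(a 0 + a 1 + a 2) / 2|),
    max_comm ((|(a 0 - a 1 + a 2) / 2|)) (|(a 0 + a 1 - a 2) / 2|),
    max_comm ((|(a 0 - a 1 - a 2) / 2|)) (|(a 0 + a 1 - a 2) / 2|),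
    max_comm ((|(a 0 - a 1 - a 2) / 2|)) (|(a 0 - a 1 + a 2) / 2|),
    max_comm |a 1| |a 0|, max_comm |a 2| |a 0|, max_comm |a 2| |a 1|]
  simp only [hmax, e1, e2, e3, e4, e5, e6, e7, e8, e9, e10, e11, e12]
  push_cast
  ring

/-- In a sorted family the entry with the number `j` is the maximum of `2 j + 1` ordered pairs. -/
theorem sum_sum_max_of_monotone {r : ℕ} (t : Fin r → ℝ) (ht : Monotone t) :
    ∑ i, ∑ j, max (t i) (t j) = ∑ j : Fin r, (2 * ((j : ℕ) : ℝ) + 1) * t j := by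
  have h1 (i : Fin r) : ∑ j, max (t i) (t j) =
      ∑ j, (if j < i then t i else 0) + ∑ j, (if i < j then t j else 0) + t i := by
    have h3 : ∑ j, (if i = j then t i else 0) = t i := by simp
    refine Eq.trans ?_ (congrArg (_ + ·) h3)
    rw [← Finset.sum_add_distrib, ← Finset.sum_add_distrib]
    refine Finset.sum_congr rfl fun j _ => ?_
    rcases lt_trichotomy i j with h | h | h
    · simp [h, h.not_gt, h.ne, ht h.le]
    · simp [h]
    · simp [h, h.not_gt, h.ne', ht h.le]
  have h2 : ∑ i, ∑ j, (if i < j then t j else 0) = ∑ i, ∑ j, (if j < i then t i else 0) :=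
    Finset.sum_comm
  have h4 (i : Fin r) : ∑ j, (if j < i then t i else 0) = ((i : ℕ) : ℝ) * t i := by
    rw [← Finset.sum_filter, Finset.sum_const, nsmul_eq_mul]
    congr 2
    have : Finset.univ.filter (fun j => j < i) = Finset.Iio i := by ext; simp
    rw [this, Fin.card_Iio]
  simp only [h1, Finset.sum_add_distrib, h2]
  simp only [h4, ← Finset.sum_add_distrib]
  exact Finset.sum_congr rfl fun j _ => by ring

/-- The part of `ρ_q - ρ_h` in which both summands of `h` enter: `c` holds the absolute values of
the nonzero weights on `ℂ⁷` (`m = 3`) or `ℂ⁸` (`m = 4`), one for each pair `±w`, while `t` holds the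
`|bⱼ|` in increasing order and `δ` is the parity of `q = 2r + δ`. -/
def gapSum {m r : ℕ} (δ : ℝ) (c : Fin m → ℝ) (t : Fin r → ℝ) : ℝ :=
  ∑ j : Fin r, (2 * ∑ i, max (c i) (t j) - (2 * ((j : ℕ) : ℝ) + δ + m - 4) * t j) + δ * ∑ i, c i

end Formulas

/-! ### Lower bounds for `ρ_q - ρ_h` -/

section Gap

variable {m r : ℕ}

/-- `gapSum` in terms of the unsorted family. -/
theorem gapSum_comp_perm (δ : ℝ) (c : Fin m → ℝ) (s : Fin r → ℝ) (σ : Equiv.Perm (Fin r))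
    (hσ : Monotone (s ∘ σ)) : gapSum δ c (s ∘ σ) =
      ∑ i, ∑ k, 2 * max (c i) (s k) + δ * ∑ i, c i - ∑ i, ∑ j, max (s i) (s j) -
        (δ + m - 5) * ∑ k, s k := by
  have h1 : ∑ i, ∑ j, max (s i) (s j) = ∑ j : Fin r, (2 * ((j : ℕ) : ℝ) + 1) * (s ∘ σ) j := by
    rw [← sum_sum_max_of_monotone _ hσ, ← Equiv.sum_comp σ]
    exact Finset.sum_congr rfl fun i _ => (Equiv.sum_comp σ _).symm
  have h2 : ∑ k, s k = ∑ k, (s ∘ σ) k := (Equiv.sum_comp σ s).symm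
  have h3 : ∑ i, ∑ k, 2 * max (c i) (s k) = ∑ j, 2 * ∑ i, max (c i) ((s ∘ σ) j) := by
    rw [Finset.sum_comm, ← Equiv.sum_comp σ]
    simp only [Finset.mul_sum, Function.comp_apply]
  rw [h1, h2, h3, gapSum, Finset.sum_sub_distrib, Finset.mul_sum (a := δ + m - 5)]
  have h4 : ∑ j : Fin r, (2 * ((j : ℕ) : ℝ) + δ + m - 4) * (s ∘ σ) j =
      ∑ j : Fin r, (2 * ((j : ℕ) : ℝ) + 1) * (s ∘ σ) j + ∑ j, (δ + m - 5) * (s ∘ σ) j := by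
    rw [← Finset.sum_add_distrib]
    exact Finset.sum_congr rfl fun j _ => by ring
  rw [h4]
  ring

theorem gapSum_zero_left (δ : ℝ) {t : Fin r → ℝ} (ht : ∀ j, 0 ≤ t j) :
    gapSum δ (0 : Fin m → ℝ) t = ∑ j : Fin r, (m + 4 - 2 * ((j : ℕ) : ℝ) - δ) * t j := by
  simp only [gapSum, Pi.zero_apply, max_eq_right (ht _), Finset.sum_const, Finset.card_univ,
    Fintype.card_fin, nsmul_eq_mul, mul_zero, add_zero]
  exact Finset.sum_congr rfl fun j _ => by ring

theorem gapSum_zero_right (δ : ℝ) {c : Fin m → ℝ} (hc : ∀ i, 0 ≤ c i) :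
    gapSum δ c (0 : Fin r → ℝ) = (2 * r + δ) * ∑ i, c i := by
  simp only [gapSum, Pi.zero_apply, max_eq_left (hc _), Finset.sum_const, Finset.card_univ,
    Fintype.card_fin, nsmul_eq_mul, mul_zero, sub_zero]
  ring

/-- The summands of `gapSum` are nonnegative if `q = 2r + δ` is at most `m + 6`. -/
theorem gapSum_summand_nonneg {d : ℕ} (hq : 2 * r + d ≤ m + 6) (c : Fin m → ℝ) {t : Fin r → ℝ}
    (ht : ∀ j, 0 ≤ t j) (j : Fin r) :
    0 ≤ 2 * ∑ i, max (c i) (t j) - (2 * ((j : ℕ) : ℝ) + d + m - 4) * t j := by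
  have h1 : (m : ℝ) * t j ≤ ∑ i, max (c i) (t j) := by
    have := Finset.card_nsmul_le_sum Finset.univ (fun i => max (c i) (t j)) (t j)
      fun i _ => le_max_right _ _
    simpa using this
  have h2 : (2 * ((j : ℕ) : ℝ) + d) ≤ m + 4 := by
    have h3 : 2 * (j : ℕ) + d ≤ m + 4 := by have := j.2; omega
    exact_mod_cast h3
  nlinarith [ht j]

/-- Equality in the case `c = 0`. -/
theorem mul_eq_zero_of_gapSum_zero_left {d : ℕ} (hq : 2 * r + d ≤ m + 6) {t : Fin r → ℝ}
    (ht : ∀ j, 0 ≤ t j) (h : gapSum d (0 : Fin m → ℝ) t ≤ 0) (j : Fin r) :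
    ((m + 4 : ℝ) - 2 * ((j : ℕ) : ℝ) - d) * t j = 0 := by
  have h0 (j : Fin r) (_ : j ∈ Finset.univ) :
      0 ≤ ((m + 4 : ℝ) - 2 * ((j : ℕ) : ℝ) - d) * t j := by
    have h3 : 2 * (j : ℕ) + d ≤ m + 4 := by have := j.2; omega
    have h2 : (2 * ((j : ℕ) : ℝ) + d) ≤ m + 4 := by exact_mod_cast h3
    exact mul_nonneg (by linarith) (ht j)
  rw [gapSum_zero_left _ ht] at h
  exact (Finset.sum_eq_zero_iff_of_nonneg h0).1 (le_antisymm h (Finset.sum_nonneg h0)) j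
    (Finset.mem_univ j)

/-- The first summand alone is at least `2 ∑ cᵢ`. -/
theorem two_mul_sum_le_gapSum {d : ℕ} (hd : d ≤ 1) (hr : 0 < r) (hq : 2 * r + d ≤ 9)
    {c : Fin 3 → ℝ} (hc : ∀ i, 0 ≤ c i) {t : Fin r → ℝ} (ht : ∀ j, 0 ≤ t j) :
    2 * ∑ i, c i ≤ gapSum d c t := by
  have h1 := Finset.single_le_sum (fun j _ => gapSum_summand_nonneg hq c ht j)
    (Finset.mem_univ (⟨0, hr⟩ : Fin r))
  have h2 : ∑ i, c i ≤ ∑ i, max (c i) (t ⟨0, hr⟩) := Finset.sum_le_sum fun i _ => le_max_left _ _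
  have h3 : (0 : ℝ) ≤ ∑ i, c i := Finset.sum_nonneg fun i _ => hc i
  have h4 : (d : ℝ) ≤ 1 := by exact_mod_cast hd
  have h5 := mul_nonneg d.cast_nonneg h3
  have h6 := mul_nonneg (sub_nonneg.2 h4) (ht ⟨0, hr⟩)
  rw [gapSum]
  simp only [Nat.cast_zero, mul_zero, zero_add] at h1
  push_cast at h1 ⊢
  linarith

/-- For `q ≥ 3` the second summand, or the term with `δ` for odd `q`, contributes another `∑ cᵢ`. -/
theorem three_mul_sum_le_gapSum {d : ℕ} (hd : d ≤ 1) (hq : 3 ≤ 2 * r + d) (hq' : 2 * r + d ≤ 9)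
    {c : Fin 3 → ℝ} {t : Fin r → ℝ} (ht : ∀ j, 0 ≤ t j) :
    3 * ∑ i, c i ≤ gapSum d c t := by
  have h0 : 0 < r := by omega
  have h2 : ∑ i, c i ≤ ∑ i, max (c i) (t ⟨0, h0⟩) := Finset.sum_le_sum fun i _ => le_max_left _ _
  rw [gapSum]
  interval_cases d
  · have h1 : 1 < r := by omega
    have h3 := Finset.sum_le_sum_of_subset_of_nonneg
      (Finset.subset_univ {(⟨0, h0⟩ : Fin r), ⟨1, h1⟩})
      (fun j _ _ => gapSum_summand_nonneg hq' c ht j)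
    rw [Finset.sum_pair (by simp)] at h3
    have h4 : ∑ i, c i + 3 * t ⟨1, h1⟩ ≤ 2 * ∑ i, max (c i) (t ⟨1, h1⟩) := by
      simp only [Fin.sum_univ_three]
      have h5 (i : Fin 3) : c i + t ⟨1, h1⟩ ≤ 2 * max (c i) (t ⟨1, h1⟩) := by
        linarith [le_max_left (c i) (t ⟨1, h1⟩), le_max_right (c i) (t ⟨1, h1⟩)]
      linarith [h5 0, h5 1, h5 2]
    push_cast at h3 ⊢
    linarith [ht ⟨0, h0⟩, ht ⟨1, h1⟩]
  · have h3 := Finset.single_le_sum (fun j _ => gapSum_summand_nonneg hq' c ht j)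
      (Finset.mem_univ (⟨0, h0⟩ : Fin r))
    push_cast at h3 ⊢
    linarith [ht ⟨0, h0⟩]

/-- Twice the sum of `max (|aᵢ|, |aⱼ|)` for `i < j`: the sum of the `|aᵢ ± aⱼ|`, that is, `ρ` of
`so_7` without the contribution of the short roots. -/
def pairMax (a : Fin 3 → ℝ) : ℝ :=
  2 * (max |a 0| |a 1| + max |a 0| |a 2| + max |a 1| |a 2|)

/-- The absolute values of `spinHalfWt`. -/
noncomputable def spinAbs (a : Fin 3 → ℝ) (k : Fin 4) : ℝ := |spinHalfWt a k|

theorem spinAbs_nonneg (a : Fin 3 → ℝ) (k : Fin 4) : 0 ≤ spinAbs a k := abs_nonneg _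

/-- The inequality `L ≤ 3 ∑ cᵢ` with the smallest `cₖ` to spare. -/
theorem exists_pairMax_add_le (a : Fin 3 → ℝ) :
    ∃ k, pairMax a + spinAbs a k ≤ 3 * ∑ i, spinAbs a i := by
  by_contra! h
  have h0 := h 0
  have h1 := h 1
  have h2 := h 2
  have h3 := h 3
  have l0 := le_abs_self ((a 0 + a 1 + a 2) / 2)
  have l1 := le_abs_self ((a 0 + a 1 - a 2) / 2)
  have l2 := le_abs_self ((a 0 - a 1 + a 2) / 2)
  have l3 := le_abs_self ((a 0 - a 1 - a 2) / 2)
  have n0 := neg_le_abs ((a 0 + a 1 + a 2) / 2)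
  have n1 := neg_le_abs ((a 0 + a 1 - a 2) / 2)
  have n2 := neg_le_abs ((a 0 - a 1 + a 2) / 2)
  have n3 := neg_le_abs ((a 0 - a 1 - a 2) / 2)
  simp only [pairMax, spinAbs, Fin.sum_univ_four, spinHalfWt, Matrix.cons_val] at h0 h1 h2 h3
  clear h
  generalize |(a 0 + a 1 + a 2) / 2| = u0 at *
  generalize |(a 0 + a 1 - a 2) / 2| = u1 at *
  generalize |(a 0 - a 1 + a 2) / 2| = u2 at *
  generalize |(a 0 - a 1 - a 2) / 2| = u3 at *
  rcases abs_cases (a 0) with ⟨e0, s0⟩ | ⟨e0, s0⟩ <;>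
  rcases abs_cases (a 1) with ⟨e1, s1⟩ | ⟨e1, s1⟩ <;>
  rcases abs_cases (a 2) with ⟨e2, s2⟩ | ⟨e2, s2⟩ <;>
  rcases max_cases |a 0| |a 1| with ⟨m0, p0⟩ | ⟨m0, p0⟩ <;>
  rcases max_cases |a 0| |a 2| with ⟨m1, p1⟩ | ⟨m1, p1⟩ <;>
  rcases max_cases |a 1| |a 2| with ⟨m2, p2⟩ | ⟨m2, p2⟩ <;>
  linarith

/-- `L ≤ 3 ∑ cᵢ` for `so_7`. -/
theorem pairMax_le (a : Fin 3 → ℝ) : pairMax a ≤ 3 * ∑ i, spinAbs a i := by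
  obtain ⟨k, hk⟩ := exists_pairMax_add_le a
  linarith [spinAbs_nonneg a k]

/-- The inequality for `so_7 ⊕ so_3`. One of the four maxima, that with the smallest `cₖ`, is
estimated through `2 max (cₖ, t) ≥ cₖ + t`, the others through `max (cᵢ, t) ≥ cᵢ`. -/
theorem pairMax_le_sum_max (a : Fin 3 → ℝ) (t : ℝ) :
    pairMax a ≤ 2 * ∑ i, max (spinAbs a i) t - t + ∑ i, spinAbs a i := by
  obtain ⟨k, hk⟩ := exists_pairMax_add_le a
  have h1 : ∑ i, 2 * spinAbs a i - spinAbs a k + t ≤ ∑ i, 2 * max (spinAbs a i) t := by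
    rw [← Finset.add_sum_erase _ _ (Finset.mem_univ k),
      ← Finset.add_sum_erase (f := fun i => 2 * max (spinAbs a i) t) _ (Finset.mem_univ k)]
    have h2 := Finset.sum_le_sum (s := Finset.univ.erase k) (f := fun i => 2 * spinAbs a i)
      (g := fun i => 2 * max (spinAbs a i) t)
      fun i _ => mul_le_mul_of_nonneg_left (le_max_left _ _) zero_le_two
    linarith [le_max_left (spinAbs a k) t, le_max_right (spinAbs a k) t]
  rw [← Finset.mul_sum, ← Finset.mul_sum] at h1
  linarith

/-- For `q ≥ 4` there is a second summand, which makes the inequality strict unless `a = 0`. -/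
theorem pairMax_add_le_gapSum {d : ℕ} (hd : d ≤ 1) (hr : 2 ≤ r) (hq : 2 * r + d ≤ 10)
    (a : Fin 3 → ℝ) {t : Fin r → ℝ} (ht : ∀ j, 0 ≤ t j) :
    pairMax a + (1 / 2) * ∑ i, spinAbs a i ≤ gapSum d (spinAbs a) t := by
  have h0 : 0 < r := by omega
  have h1 : 1 < r := by omega
  have hc := spinAbs_nonneg a
  have h3 := Finset.sum_le_sum_of_subset_of_nonneg
    (Finset.subset_univ {(⟨0, h0⟩ : Fin r), ⟨1, h1⟩})
    (fun j _ _ => gapSum_summand_nonneg hq (spinAbs a) ht j)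
  rw [Finset.sum_pair (by simp)] at h3
  have hw := Finset.sum_nonneg fun i (_ : i ∈ Finset.univ) => hc i
  have t0 := ht ⟨0, h0⟩
  have t1 := ht ⟨1, h1⟩
  rw [gapSum]
  interval_cases d
  · have h2 : ∑ i, spinAbs a i ≤ ∑ i, max (spinAbs a i) (t ⟨0, h0⟩) :=
      Finset.sum_le_sum fun i _ => le_max_left _ _
    -- A convex combination of the two lower bounds for the maximum.
    have h4 : (3 / 2) * ∑ i, spinAbs a i + 2 * t ⟨1, h1⟩ ≤
        2 * ∑ i, max (spinAbs a i) (t ⟨1, h1⟩) := by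
      simp only [Fin.sum_univ_four]
      have h5 (i : Fin 4) :
          (3 / 2) * spinAbs a i + (1 / 2) * t ⟨1, h1⟩ ≤ 2 * max (spinAbs a i) (t ⟨1, h1⟩) := by
        linarith [le_max_left (spinAbs a i) (t ⟨1, h1⟩), le_max_right (spinAbs a i) (t ⟨1, h1⟩)]
      linarith [h5 0, h5 1, h5 2, h5 3]
    have h6 := pairMax_le a
    push_cast at h3 ⊢
    linarith
  · have h2 := pairMax_le_sum_max a (t ⟨0, h0⟩)
    have h4 : ∑ i, spinAbs a i + 4 * t ⟨1, h1⟩ ≤ 2 * ∑ i, max (spinAbs a i) (t ⟨1, h1⟩) := by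
      simp only [Fin.sum_univ_four]
      have h5 (i : Fin 4) : spinAbs a i + t ⟨1, h1⟩ ≤ 2 * max (spinAbs a i) (t ⟨1, h1⟩) := by
        linarith [le_max_left (spinAbs a i) (t ⟨1, h1⟩), le_max_right (spinAbs a i) (t ⟨1, h1⟩)]
      linarith [h5 0, h5 1, h5 2, h5 3]
    push_cast at h3 ⊢
    linarith

theorem spinAbs_eq_zero_iff (a : Fin 3 → ℝ) : spinAbs a = 0 ↔ a = 0 := by
  constructor
  · intro h
    have h' (k : Fin 4) : spinHalfWt a k = 0 := abs_eq_zero.1 (congrFun h k)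
    have h0 := h' 0
    have h1 := h' 1
    have h2 := h' 2
    simp only [spinHalfWt, Matrix.cons_val] at h0 h1 h2
    ext i
    fin_cases i <;> simp <;> linarith
  · rintro rfl
    ext k
    fin_cases k <;> simp [spinAbs, spinHalfWt]

theorem g2Wt_eq_zero_iff {a : Fin 3 → ℝ} (ha : a ∈ g2Split) :
    (fun i => |g2Wt a i|) = 0 ↔ a = 0 := by
  constructor
  · intro h
    have h' (k : Fin 3) : g2Wt a k = 0 := abs_eq_zero.1 (congrFun h k)
    have h0 := h' 0
    have h1 := h' 1
    simp only [g2Wt, Matrix.cons_val] at h0 h1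
    simp only [g2Split, Set.mem_ofPred_eq] at ha
    ext i
    fin_cases i <;> simp <;> linarith
  · rintro rfl
    ext k
    fin_cases k <;> simp [g2Wt]

end Gap

/-! ### Formulas for `ρ_h` and `ρ_q` -/

section Rho

theorem rhoWt_torusWt_seven (a : Fin 3 → ℝ) :
    rhoWt (torusWt 7 a) = pairMax a + ∑ i, |a i| := by
  rw [rhoWt_torusWt]
  change ∑ i : Fin 3, ∑ j : Fin 3, max |a i| |a j| + (((1 : ℕ) : ℝ) - 1) * ∑ i : Fin 3, |a i| = _
  simp only [Fin.sum_univ_three, pairMax, max_self, max_comm |a 1| |a 0|, max_comm |a 2| |a 0|,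
    max_comm |a 2| |a 1|]
  push_cast
  ring

/-- The adjoint representation of `so_7` restricts to `g₂` as the sum of the adjoint and the
seven-dimensional representation. -/
theorem rhoWt_torusWt_g2Wt {a : Fin 3 → ℝ} (ha : a ∈ g2Split) :
    rhoWt (torusWt 7 (g2Wt a)) = 2 * ∑ i, |g2Wt a i| + 3 * ∑ i, |a i| := by
  have hmax (x y : ℝ) : max |x| |y| = (|x + y| + |x - y|) / 2 := by
    rw [abs_add_add_abs_sub]
    ring
  have h3 (x : ℝ) : |3 * x| = 3 * |x| := by rw [abs_mul, abs_of_pos (by norm_num : (0 : ℝ) < 3)]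
  simp only [g2Split, Set.mem_ofPred_eq] at ha
  have e1 : a 2 - a 1 + (a 2 - a 0) = 3 * a 2 := by linarith
  have e2 : a 2 - a 1 - (a 2 - a 0) = a 0 - a 1 := by ring
  have e3 : a 2 - a 1 + (a 0 - a 1) = -(3 * a 1) := by linarith
  have e4 : a 2 - a 1 - (a 0 - a 1) = a 2 - a 0 := by ring
  have e5 : a 2 - a 0 + (a 0 - a 1) = a 2 - a 1 := by ring
  have e6 : a 2 - a 0 - (a 0 - a 1) = -(3 * a 0) := by linarith
  rw [rhoWt_torusWt_seven]
  simp only [pairMax, Fin.sum_univ_three, g2Wt, Matrix.cons_val]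
  simp only [hmax, e1, e2, e3, e4, e5, e6, abs_neg, h3]
  ring

theorem sum_abs_add_torusWt_seven (q : ℕ) (c : Fin 3 → ℝ) (b : Fin (q / 2) → ℝ) :
    (1 / 2) * ∑ i, ∑ j, |torusWt 7 c i + torusWt q b j| =
      ∑ i, ∑ k, 2 * max |c i| |b k| + ((q % 2 : ℕ) : ℝ) * ∑ i, |c i| + ∑ k, |b k| := by
  have h (x : ℝ) : max 0 |x| = |x| := max_eq_right (abs_nonneg x)
  simp only [sum_abs_add_torusWt]
  rw [sum_torusWt 7 c fun y => ∑ k, 2 * max |y| |b k| + ((q % 2 : ℕ) : ℝ) * |y|]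
  simp only [abs_neg, abs_zero, mul_zero, add_zero, Finset.sum_add_distrib, ← Finset.mul_sum, h]
  norm_num
  ring

theorem sum_abs_add_spinWt_torusWt (q : ℕ) (a : Fin 3 → ℝ) (b : Fin (q / 2) → ℝ) :
    (1 / 2) * ∑ i, ∑ j, |spinWt a i + torusWt q b j| =
      ∑ i, ∑ k, 2 * max (spinAbs a i) |b k| + ((q % 2 : ℕ) : ℝ) * ∑ i, spinAbs a i := by
  simp only [sum_abs_add_torusWt]
  rw [sum_spinWt a fun y => ∑ k, 2 * max |y| |b k| + ((q % 2 : ℕ) : ℝ) * |y|]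
  simp only [abs_neg, Finset.sum_add_distrib, ← Finset.mul_sum, spinAbs]
  ring

theorem rhoSub_vecG2 (q : ℕ) {a : Fin 3 → ℝ} (ha : a ∈ g2Split) (b : Fin (q / 2) → ℝ) :
    rhoSub (hG2 q) (vecG2 q a b) =
      ∑ i, |g2Wt a i| + 3 * ∑ i, |a i| + rhoWt (torusWt q b) := by
  obtain ⟨P, Q, h⟩ := diagonalizes_soTorus q b
  refine (rhoSub_pairHom g2Rep q (g2Torus a) (soTorus q b)).trans ?_
  rw [rhoSub_g2 ha, rhoEnd_ad_so h]
  simp only [Fin.sum_univ_three, g2Wt, Matrix.cons_val]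

theorem rhoSub_vecSpin (q : ℕ) (a : Fin 3 → ℝ) (b : Fin (q / 2) → ℝ) :
    rhoSub (hSpin q) (vecSpin q a b) = pairMax a + ∑ i, |a i| + rhoWt (torusWt q b) := by
  obtain ⟨P, Q, h⟩ := diagonalizes_soTorus q b
  obtain ⟨P', Q', h'⟩ := diagonalizes_soTorus 7 a
  refine (rhoSub_pairHom spinRep q (soTorus 7 a) (soTorus q b)).trans ?_
  rw [rhoSub_range_of_injective _ spinRep_injective, rhoEnd_ad_so h, rhoEnd_ad_so h',
    rhoWt_torusWt_seven]

/-- `ρ_q - ρ_h` for `g₂ ⊕ so_q`, after sorting the `|bⱼ|`. -/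
theorem rhoQuot_vecG2 (q : ℕ) {a : Fin 3 → ℝ} (ha : a ∈ g2Split) (b : Fin (q / 2) → ℝ)
    (σ : Equiv.Perm (Fin (q / 2))) (hσ : Monotone ((fun j => |b j|) ∘ σ)) :
    rhoQuot (hG2 q) (vecG2 q a b) = rhoSub (hG2 q) (vecG2 q a b) +
      (gapSum ((q % 2 : ℕ) : ℝ) (fun i => |g2Wt a i|) ((fun j => |b j|) ∘ σ) -
        3 * ∑ i, |a i|) := by
  obtain ⟨P, Q, h⟩ := diagonalizes_g2 ha
  have h1 : rhoSub (hG2 q) (vecG2 q a b) + rhoQuot (hG2 q) (vecG2 q a b) = _ :=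
    rhoSub_add_rhoQuot_pairHom g2Rep q (g2Torus a) b h
  rw [rhoWt_torusWt_g2Wt ha, sum_abs_add_torusWt_seven] at h1
  rw [gapSum_comp_perm _ _ _ _ hσ]
  rw [rhoSub_vecG2 q ha] at h1 ⊢
  rw [rhoWt_torusWt] at h1 ⊢
  push_cast at h1 ⊢
  linarith

/-- `ρ_q - ρ_h` for `so_7 ⊕ so_q`, after sorting the `|bⱼ|`. -/
theorem rhoQuot_vecSpin (q : ℕ) (a : Fin 3 → ℝ) (b : Fin (q / 2) → ℝ)
    (σ : Equiv.Perm (Fin (q / 2))) (hσ : Monotone ((fun j => |b j|) ∘ σ)) :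
    rhoQuot (hSpin q) (vecSpin q a b) = rhoSub (hSpin q) (vecSpin q a b) +
      (gapSum ((q % 2 : ℕ) : ℝ) (spinAbs a) ((fun j => |b j|) ∘ σ) - pairMax a) := by
  obtain ⟨P, Q, h⟩ := diagonalizes_spin a
  have h1 : rhoSub (hSpin q) (vecSpin q a b) + rhoQuot (hSpin q) (vecSpin q a b) = _ :=
    rhoSub_add_rhoQuot_pairHom spinRep q (soTorus 7 a) b h
  rw [rhoWt_spinWt, rhoWt_torusWt_seven, sum_abs_add_spinWt_torusWt] at h1
  rw [gapSum_comp_perm _ _ _ _ hσ]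
  rw [rhoSub_vecSpin] at h1 ⊢
  rw [rhoWt_torusWt] at h1 ⊢
  push_cast at h1 ⊢
  linarith

end Rho

/-! ### Test vectors and positivity -/

section Extremal

/-- For `q ≥ 3` the function `ρ` of `so_q` is positive away from zero. -/
theorem le_rhoWt_torusWt (q : ℕ) (hq : 3 ≤ q) (b : Fin (q / 2) → ℝ) :
    ∑ k, |b k| ≤ rhoWt (torusWt q b) := by
  have h1 : ((q / 2 : ℕ) : ℝ) * ∑ k, |b k| ≤ ∑ i, ∑ j, max |b i| |b j| := by
    have h2 : ∑ i, ∑ j, (|b i| + |b j|) / 2 ≤ ∑ i, ∑ j, max |b i| |b j| :=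
      Finset.sum_le_sum fun i _ => Finset.sum_le_sum fun j _ => by
        linarith [le_max_left |b i| |b j|, le_max_right |b i| |b j|]
    refine le_trans (le_of_eq ?_) h2
    simp only [← Finset.sum_div, Finset.sum_add_distrib, Finset.sum_const, Finset.card_univ,
      Fintype.card_fin, nsmul_eq_mul, ← Finset.mul_sum]
    ring
  have h3 : (2 : ℝ) ≤ ((q / 2 : ℕ) : ℝ) + ((q % 2 : ℕ) : ℝ) := by
    have : 2 ≤ q / 2 + q % 2 := by omega
    exact_mod_cast this
  have h4 : 0 ≤ ∑ k, |b k| := Finset.sum_nonneg fun k _ => abs_nonneg _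
  rw [rhoWt_torusWt]
  nlinarith

theorem rhoWt_zero {J : Type*} [Fintype J] : rhoWt (0 : J → ℝ) = 0 := by
  simp [rhoWt]

theorem torusWt_zero (q : ℕ) : torusWt q 0 = 0 := by
  ext (p | z) <;> simp [torusWt]

theorem soTorus_zero (q : ℕ) : soTorus q 0 = 0 := by
  simp [soTorus]

theorem vecG2_zero (q : ℕ) : vecG2 q 0 0 = 0 := by
  have h : g2Torus 0 = 0 := by simp [g2Torus]
  rw [vecG2, h, soTorus_zero]
  exact map_zero (pairHom g2Rep q).rangeRestrict

theorem vecSpin_zero (q : ℕ) : vecSpin q 0 0 = 0 := by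
  rw [vecSpin, soTorus_zero, soTorus_zero]
  exact map_zero (pairHom spinRep q).rangeRestrict

theorem ne_zero_of_rhoSub_pos {g : Type*} [LieRing g] [LieAlgebra ℂ g] [Module.Finite ℂ g]
    {h : LieSubalgebra ℂ g} {Y : h} (hY : 0 < rhoSub h Y) : Y ≠ 0 := by
  rintro rfl
  exact hY.ne' (rhoSub_zero h)

/-- Since `ρ_h` vanishes at zero, a witness vector need not be required to be nonzero. -/
theorem isWitness_iff_rhoSub_pos {g : Type*} [LieRing g] [LieAlgebra ℂ g] [Module.Finite ℂ g]
    {h : LieSubalgebra ℂ g} {Y : h} :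
    IsWitness h Y ↔ rhoQuot h Y = rhoSub h Y ∧ 0 < rhoSub h Y :=
  ⟨fun hY => ⟨hY.2.1.symm, hY.2.1 ▸ hY.2.2⟩,
    fun hY => ⟨ne_zero_of_rhoSub_pos hY.2, hY.1.symm, hY.1 ▸ hY.2⟩⟩

theorem exists_perm_monotone {r : ℕ} (s : Fin r → ℝ) : ∃ σ : Equiv.Perm (Fin r),
    Monotone (s ∘ σ) := ⟨Tuple.sort s, Tuple.monotone_sort s⟩

/-- The vector `(0, …, 0, 1)`: the only nonzero coordinate is the last one, so that it is sorted in
increasing order. -/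
def lastUnit (r : ℕ) : Fin r → ℝ := fun j => if (j : ℕ) + 1 = r then 1 else 0

theorem monotone_abs_lastUnit (r : ℕ) :
    Monotone ((fun j => |lastUnit r j|) ∘ (1 : Equiv.Perm (Fin r))) := by
  intro i j hij
  have h1 : (i : ℕ) ≤ j := hij
  have h2 := j.2
  simp only [Function.comp_apply, Equiv.Perm.coe_one, id, lastUnit]
  by_cases hi : (i : ℕ) + 1 = r
  · have hj : (j : ℕ) + 1 = r := by omega
    simp [hi, hj]
  · simp [hi]

theorem gapSum_lastUnit {m : ℕ} {q : ℕ} (hq : 2 ≤ q) :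
    gapSum ((q % 2 : ℕ) : ℝ) (0 : Fin m → ℝ)
      ((fun j => |lastUnit (q / 2) j|) ∘ (1 : Equiv.Perm (Fin (q / 2)))) = m + 6 - q := by
  have hr : q / 2 - 1 < q / 2 := by omega
  rw [gapSum_zero_left (t := (fun j => |lastUnit (q / 2) j|) ∘ (1 : Equiv.Perm (Fin (q / 2)))) _
    (fun j => abs_nonneg _), Finset.sum_eq_single (⟨q / 2 - 1, hr⟩ : Fin (q / 2))]
  · have h1 : q / 2 - 1 + 1 = q / 2 := by omega
    have h2 : (2 * ((q / 2 - 1 : ℕ) : ℝ) + 2 + ((q % 2 : ℕ) : ℝ)) = q := by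
      have : 2 * (q / 2 - 1) + 2 + q % 2 = q := by omega
      exact_mod_cast this
    simp only [Function.comp_apply, Equiv.Perm.coe_one, id, lastUnit, h1, if_true, abs_one, mul_one]
    linarith
  · intro j _ hj
    have h1 : ¬ (j : ℕ) + 1 = q / 2 := fun h => hj (Fin.ext (by simp only; omega))
    simp [lastUnit, h1]
  · simp

theorem sum_abs_lastUnit_pos {r : ℕ} (hr : 0 < r) : 0 < ∑ k, |lastUnit r k| := by
  refine Finset.sum_pos' (fun k _ => abs_nonneg _) ⟨⟨r - 1, by omega⟩, Finset.mem_univ _, ?_⟩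
  have : r - 1 + 1 = r := by omega
  simp [lastUnit, this]

theorem abs_comp_perm_eq_zero {r : ℕ} {b : Fin r → ℝ} {σ : Equiv.Perm (Fin r)}
    (h : ∀ j, ((fun j => |b j|) ∘ σ) j = 0) : b = 0 := by
  ext j
  have h1 := h (σ.symm j)
  simpa using h1

end Extremal

/-! ### The pairs with `g₂` -/

section G2

/-- `L ≤ 2 ∑ cᵢ` for `g₂`. -/
theorem three_mul_sum_abs_le {a : Fin 3 → ℝ} (ha : a ∈ g2Split) :
    3 * ∑ i, |a i| ≤ 2 * ∑ i, |g2Wt a i| := by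
  simp only [g2Split, Set.mem_ofPred_eq] at ha
  have h1 : 3 * |a 0| ≤ |a 2 - a 0| + |a 0 - a 1| := by
    have := abs_sub (a 2 - a 0) (a 0 - a 1)
    have e : a 2 - a 0 - (a 0 - a 1) = -(3 * a 0) := by linarith
    rwa [e, abs_neg, abs_mul, abs_of_pos (by norm_num : (0 : ℝ) < 3)] at this
  have h2 : 3 * |a 1| ≤ |a 2 - a 1| + |a 0 - a 1| := by
    have := abs_add_le (a 2 - a 1) (a 0 - a 1)
    have e : a 2 - a 1 + (a 0 - a 1) = -(3 * a 1) := by linarith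
    rwa [e, abs_neg, abs_mul, abs_of_pos (by norm_num : (0 : ℝ) < 3)] at this
  have h3 : 3 * |a 2| ≤ |a 2 - a 1| + |a 2 - a 0| := by
    have := abs_add_le (a 2 - a 1) (a 2 - a 0)
    have e : a 2 - a 1 + (a 2 - a 0) = 3 * a 2 := by linarith
    rwa [e, abs_mul, abs_of_pos (by norm_num : (0 : ℝ) < 3)] at this
  simp only [Fin.sum_univ_three, g2Wt, Matrix.cons_val]
  linarith

theorem rhoSub_le_rhoQuot_vecG2 {q : ℕ} (hq : 2 ≤ q) (hq' : q ≤ 9) {a : Fin 3 → ℝ}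
    (ha : a ∈ g2Split) (b : Fin (q / 2) → ℝ) :
    rhoSub (hG2 q) (vecG2 q a b) ≤ rhoQuot (hG2 q) (vecG2 q a b) := by
  obtain ⟨σ, hσ⟩ := exists_perm_monotone fun j => |b j|
  have h1 := two_mul_sum_le_gapSum (d := q % 2) (r := q / 2) (by omega) (by omega) (by omega)
    (c := fun i => |g2Wt a i|) (fun i => abs_nonneg _) (t := (fun j => |b j|) ∘ σ)
    fun j => abs_nonneg _
  rw [rhoQuot_vecG2 q ha b σ hσ]
  linarith [three_mul_sum_abs_le ha]

/-- In the case of equality the component in `g₂` vanishes, and so do all `bⱼ` with the possible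
exception of the largest one if `q = 9`. -/
theorem eq_zero_of_rhoQuot_le_vecG2 {q : ℕ} (hq : 3 ≤ q) (hq' : q ≤ 9) {a : Fin 3 → ℝ}
    (ha : a ∈ g2Split) (b : Fin (q / 2) → ℝ) (σ : Equiv.Perm (Fin (q / 2)))
    (hσ : Monotone ((fun j => |b j|) ∘ σ))
    (h : rhoQuot (hG2 q) (vecG2 q a b) ≤ rhoSub (hG2 q) (vecG2 q a b)) :
    a = 0 ∧ ∀ j : Fin (q / 2), 2 * (j : ℕ) + q % 2 < 7 → b (σ j) = 0 := by
  have h1 := three_mul_sum_le_gapSum (d := q % 2) (r := q / 2) (by omega) (by omega) (by omega)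
    (c := fun i => |g2Wt a i|) (t := (fun j => |b j|) ∘ σ) fun j => abs_nonneg _
  rw [rhoQuot_vecG2 q ha b σ hσ] at h
  have h2 := three_mul_sum_abs_le ha
  have h3 : ∑ i, |g2Wt a i| = 0 :=
    le_antisymm (by linarith) (Finset.sum_nonneg fun i _ => abs_nonneg _)
  have h4 : (fun i => |g2Wt a i|) = 0 := by
    ext i
    exact (Finset.sum_eq_zero_iff_of_nonneg fun i _ => abs_nonneg _).1 h3 i (Finset.mem_univ i)
  have ha0 := (g2Wt_eq_zero_iff ha).1 h4
  refine ⟨ha0, fun j hj => ?_⟩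
  rw [h4, ha0] at h
  have h5 := mul_eq_zero_of_gapSum_zero_left (m := 3) (d := q % 2) (r := q / 2)
    (t := (fun j => |b j|) ∘ σ) (by omega) (fun j => abs_nonneg _) (by simpa using h) j
  have h6 : (2 * ((j : ℕ) : ℝ) + ((q % 2 : ℕ) : ℝ)) < 7 := by exact_mod_cast hj
  rcases mul_eq_zero.1 h5 with h7 | h7
  · push_cast at h7 h6
    linarith
  · exact abs_eq_zero.1 h7

/-- The test vector `a = (-1, -1, 2)`, `b = 0`, for which the nonzero weights on `ℂ⁷` are `±3`, `±3`
and `L = 12`. It violates the inequality for small `q`. -/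
theorem exists_vecG2_small (q : ℕ) : ∃ Y ∈ aG2 q, 0 < rhoSub (hG2 q) Y ∧
    rhoQuot (hG2 q) Y = rhoSub (hG2 q) Y + (6 * q - 12) := by
  have ha : ![-1, -1, 2] ∈ g2Split := by
    simp only [g2Split, Set.mem_ofPred_eq, Matrix.cons_val]
    norm_num
  have h0 : (fun j : Fin (q / 2) => |(0 : Fin (q / 2) → ℝ) j|) ∘
      (1 : Equiv.Perm (Fin (q / 2))) = 0 := by
    ext
    simp
  have hc : ∑ i, |g2Wt ![-1, -1, 2] i| = 6 := by
    simp only [g2Wt, Fin.sum_univ_three, Matrix.cons_val]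
    norm_num
  have hl : ∑ i, |(![-1, -1, 2] : Fin 3 → ℝ) i| = 4 := by
    simp only [Fin.sum_univ_three, Matrix.cons_val]
    norm_num
  refine ⟨vecG2 q ![-1, -1, 2] 0, ⟨_, ha, _, rfl⟩, ?_, ?_⟩
  · rw [rhoSub_vecG2 q ha, hc, hl, torusWt_zero, rhoWt_zero]
    norm_num
  · rw [rhoQuot_vecG2 q ha 0 1 (by rw [h0]; exact monotone_const), h0,
      gapSum_zero_right _ fun i => abs_nonneg _, hc, hl]
    have h : 2 * ((q / 2 : ℕ) : ℝ) + ((q % 2 : ℕ) : ℝ) = q := by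
      exact_mod_cast Nat.div_add_mod q 2
    rw [h]
    ring

theorem zero_mem_g2Split : (0 : Fin 3 → ℝ) ∈ g2Split := by
  simp [g2Split]

/-- The test vector `a = 0`, `b = (0, …, 0, 1)`, which violates the inequality for large `q`. -/
theorem exists_vecG2_large {q : ℕ} (hq : 3 ≤ q) : ∃ Y ∈ aG2 q, 0 < rhoSub (hG2 q) Y ∧
    rhoQuot (hG2 q) Y = rhoSub (hG2 q) Y + (9 - q) := by
  refine ⟨vecG2 q 0 (lastUnit _), ⟨_, zero_mem_g2Split, _, rfl⟩, ?_, ?_⟩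
  · rw [rhoSub_vecG2 q zero_mem_g2Split]
    have h1 := le_rhoWt_torusWt q hq (lastUnit _)
    have h2 := sum_abs_lastUnit_pos (r := q / 2) (by omega)
    have h3 : 0 ≤ ∑ i, |g2Wt 0 i| := Finset.sum_nonneg fun i _ => abs_nonneg _
    simp only [Pi.zero_apply, abs_zero, Finset.sum_const_zero]
    linarith
  · rw [rhoQuot_vecG2 q zero_mem_g2Split _ 1 (monotone_abs_lastUnit _),
      (g2Wt_eq_zero_iff zero_mem_g2Split).2 rfl, gapSum_lastUnit (by omega)]
    simp only [Pi.zero_apply, abs_zero, Finset.sum_const_zero]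
    push_cast
    ring

theorem rhoLE_hG2_iff (q : ℕ) : RhoLE (hG2 q) (aG2 q) ↔ 2 ≤ q ∧ q ≤ 9 := by
  constructor
  · intro h
    constructor
    · obtain ⟨Y, hY, -, h1⟩ := exists_vecG2_small q
      have h2 := h Y hY
      have h3 : (2 : ℝ) ≤ q := by linarith
      exact_mod_cast h3
    · by_contra! hq
      obtain ⟨Y, hY, -, h1⟩ := exists_vecG2_large (q := q) (by omega)
      have h2 := h Y hY
      have h3 : (q : ℝ) ≤ 9 := by linarith
      exact absurd (by exact_mod_cast h3) (not_le.2 hq)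
  · rintro ⟨hq, hq'⟩ _ ⟨a, ha, b, rfl⟩
    exact rhoSub_le_rhoQuot_vecG2 hq hq' ha b

theorem rhoLT_hG2_iff (q : ℕ) : RhoLT (hG2 q) (aG2 q) ↔ 3 ≤ q ∧ q ≤ 8 := by
  constructor
  · intro h
    constructor
    · obtain ⟨Y, hY, h0, h1⟩ := exists_vecG2_small q
      have h2 := h Y hY (ne_zero_of_rhoSub_pos h0)
      have h3 : (2 : ℝ) < q := by linarith
      exact_mod_cast h3
    · by_contra! hq
      obtain ⟨Y, hY, h0, h1⟩ := exists_vecG2_large (q := q) (by omega)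
      have h2 := h Y hY (ne_zero_of_rhoSub_pos h0)
      have h3 : (q : ℝ) < 9 := by linarith
      have h4 : q < 9 := by exact_mod_cast h3
      omega
  · rintro ⟨hq, hq'⟩ _ ⟨a, ha, b, rfl⟩ hY
    by_contra! h
    obtain ⟨σ, hσ⟩ := exists_perm_monotone fun j => |b j|
    obtain ⟨h1, h2⟩ := eq_zero_of_rhoQuot_le_vecG2 hq (by omega) ha b σ hσ h
    have h3 : b = 0 := abs_comp_perm_eq_zero (σ := σ) fun j => by
      have h4 := h2 j (by have := j.2; omega)
      simp [h4]
    rw [h1, h3, vecG2_zero] at hY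
    exact hY rfl

theorem isWitness_vecG2_two {a : Fin 3 → ℝ} (ha : a ∈ g2Chamber) (b : Fin 1 → ℝ) :
    IsWitness (hG2 2) (vecG2 2 a b) ↔ a ≠ 0 ∧ a 0 = a 1 ∧ b 0 = 0 := by
  obtain ⟨ha, h10, h0, h2⟩ := ha
  have hs : rhoSub (hG2 2) (vecG2 2 a b) = ∑ i, |g2Wt a i| + 3 * ∑ i, |a i| := by
    have h := rhoSub_vecG2 2 ha b
    have hb : rhoWt (torusWt 2 b) = 0 := by
      rw [rhoWt_torusWt]
      change ∑ i : Fin 1, ∑ j : Fin 1, max |b i| |b j| +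
        (((0 : ℕ) : ℝ) - 1) * ∑ i : Fin 1, |b i| = 0
      simp
    rw [h, hb, add_zero]
  have hg : rhoQuot (hG2 2) (vecG2 2 a b) = rhoSub (hG2 2) (vecG2 2 a b) +
      (2 * ∑ i, max |g2Wt a i| |b 0| + |b 0| - 3 * ∑ i, |a i|) := by
    have h := rhoQuot_vecG2 2 ha b 1 (Subsingleton.monotone (α := Fin 1) _)
    have e : gapSum ((2 % 2 : ℕ) : ℝ) (fun i => |g2Wt a i|)
        ((fun j => |b j|) ∘ (1 : Equiv.Perm (Fin 1))) =
        2 * ∑ i, max |g2Wt a i| |b 0| + |b 0| := by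
      simp [gapSum]
      ring
    rw [← e]
    exact h
  have hpos : 0 < rhoSub (hG2 2) (vecG2 2 a b) ↔ a ≠ 0 := by
    rw [hs]
    constructor
    · rintro h rfl
      simp [g2Wt, Fin.sum_univ_three] at h
    · intro h
      have h1 : 0 ≤ ∑ i, |g2Wt a i| := Finset.sum_nonneg fun i _ => abs_nonneg _
      obtain ⟨i, hi⟩ := Function.ne_iff.1 h
      have h3 : 0 < ∑ i, |a i| :=
        Finset.sum_pos' (fun i _ => abs_nonneg _) ⟨i, Finset.mem_univ i, abs_pos.2 hi⟩
      linarith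
  rw [isWitness_iff_rhoSub_pos, hpos, hg, and_comm, and_congr_right_iff]
  intro _
  have hsum : a 0 + a 1 + a 2 = 0 := ha
  simp only [Fin.sum_univ_three, g2Wt, Matrix.cons_val, abs_of_nonpos h0,
    abs_of_nonpos (h10.trans h0), abs_of_nonneg h2, abs_of_nonneg (by linarith : 0 ≤ a 2 - a 1),
    abs_of_nonneg (by linarith : 0 ≤ a 2 - a 0), abs_of_nonneg (by linarith : 0 ≤ a 0 - a 1)]
  have hb := abs_nonneg (b 0)
  constructor
  · intro h
    have m0 := le_max_left (a 2 - a 1) |b 0|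
    have m1 := le_max_left (a 2 - a 0) |b 0|
    have m2 := le_max_left (a 0 - a 1) |b 0|
    exact ⟨by linarith, abs_eq_zero.1 (by linarith)⟩
  · rintro ⟨h, hb0⟩
    rw [hb0, abs_zero, max_eq_left (by linarith), max_eq_left (by linarith),
      max_eq_left (by linarith)]
    linarith

theorem isWitness_vecG2_nine {a : Fin 3 → ℝ} (ha : a ∈ g2Chamber) {b : Fin 4 → ℝ}
    (hb : b ∈ soChamber 9) : IsWitness (hG2 9) (vecG2 9 a b) ↔
      0 < b 0 ∧ a 0 = 0 ∧ a 1 = 0 ∧ a 2 = 0 ∧ b 1 = 0 ∧ b 2 = 0 ∧ b 3 = 0 := by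
  have hσ : Monotone ((fun j => |b j|) ∘ (Fin.revPerm : Equiv.Perm (Fin 4))) := by
    intro i j hij
    rcases hij.eq_or_lt with rfl | hij
    · exact le_rfl
    · exact (hb.1 _ _ (Fin.rev_lt_rev.2 hij)).trans (le_abs_self _)
  have hb0 : 0 ≤ b 0 := hb.2 (by decide) 0
  rw [isWitness_iff_rhoSub_pos]
  constructor
  · rintro ⟨h, hpos⟩
    obtain ⟨rfl, h1⟩ := eq_zero_of_rhoQuot_le_vecG2 (q := 9) (by norm_num) le_rfl ha.1 b
      Fin.revPerm hσ h.le
    have b1 : b 1 = 0 := h1 2 (by decide)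
    have b2 : b 2 = 0 := h1 1 (by decide)
    have b3 : b 3 = 0 := h1 0 (by decide)
    refine ⟨hb0.lt_of_ne' fun b0 => hpos.ne' ?_, rfl, rfl, rfl, b1, b2, b3⟩
    have hz : b = 0 := by
      ext i
      fin_cases i <;> assumption
    subst hz
    exact (congrArg _ (vecG2_zero 9)).trans (rhoSub_zero _)
  · rintro ⟨b0, a0, a1, a2, b1, b2, b3⟩
    have hz : a = 0 := by
      ext i
      fin_cases i <;> assumption
    subst hz
    constructor
    · have h := rhoQuot_vecG2 9 zero_mem_g2Split b Fin.revPerm hσ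
      rw [(g2Wt_eq_zero_iff zero_mem_g2Split).2 rfl] at h
      have e : gapSum ((9 % 2 : ℕ) : ℝ) (0 : Fin 3 → ℝ)
          ((fun j => |b j|) ∘ (Fin.revPerm : Equiv.Perm (Fin 4))) = 0 := by
        rw [gapSum_zero_left (t := (fun j => |b j|) ∘ (Fin.revPerm : Equiv.Perm (Fin 4))) _
          fun j => abs_nonneg _]
        simp [Fin.sum_univ_four, Fin.rev, b1, b2, b3]
        norm_num
      refine h.trans ?_
      erw [e]
      simp
    · have h1 := le_rhoWt_torusWt 9 (by norm_num) b
      have h2 : 0 < ∑ k : Fin 4, |b k| :=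
        Finset.sum_pos' (fun i _ => abs_nonneg _) ⟨0, Finset.mem_univ _, abs_pos.2 b0.ne'⟩
      have h3 : 0 ≤ ∑ i, |g2Wt 0 i| := Finset.sum_nonneg fun i _ => abs_nonneg _
      have h4 : 0 ≤ ∑ i, |(0 : Fin 3 → ℝ) i| := Finset.sum_nonneg fun i _ => abs_nonneg _
      have h5 := rhoSub_vecG2 9 zero_mem_g2Split b
      have h6 : ∑ k : Fin 4, |b k| ≤ rhoWt (torusWt 9 b) := h1
      have h7 : rhoSub (hG2 9) (vecG2 9 0 b) = _ := h5
      rw [h7]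
      linarith

end G2

/-! ### The pairs with the spin representation -/

section Spin

theorem rhoQuot_vecSpin_three (a : Fin 3 → ℝ) (b : Fin 1 → ℝ) :
    rhoQuot (hSpin 3) (vecSpin 3 a b) = rhoSub (hSpin 3) (vecSpin 3 a b) +
      (2 * ∑ i, max (spinAbs a i) |b 0| - |b 0| + ∑ i, spinAbs a i - pairMax a) := by
  have h := rhoQuot_vecSpin 3 a b 1 (Subsingleton.monotone (α := Fin 1) _)
  have e : gapSum ((3 % 2 : ℕ) : ℝ) (spinAbs a)
      ((fun j => |b j|) ∘ (1 : Equiv.Perm (Fin 1))) =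
      2 * ∑ i, max (spinAbs a i) |b 0| - |b 0| + ∑ i, spinAbs a i := by
    simp [gapSum]
  rw [← e]
  exact h

theorem rhoSub_le_rhoQuot_vecSpin {q : ℕ} (hq : 3 ≤ q) (hq' : q ≤ 10) (a : Fin 3 → ℝ)
    (b : Fin (q / 2) → ℝ) :
    rhoSub (hSpin q) (vecSpin q a b) ≤ rhoQuot (hSpin q) (vecSpin q a b) := by
  rcases hq.eq_or_lt with rfl | hq
  · have h1 := rhoQuot_vecSpin_three a b
    have h2 := pairMax_le_sum_max a |b (0 : Fin 1)|
    refine le_trans ?_ h1.ge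
    linarith
  · obtain ⟨σ, hσ⟩ := exists_perm_monotone fun j => |b j|
    have h1 := pairMax_add_le_gapSum (d := q % 2) (r := q / 2) (by omega) (by omega) (by omega) a
      (t := (fun j => |b j|) ∘ σ) fun j => abs_nonneg _
    have h2 := Finset.sum_nonneg fun i (_ : i ∈ Finset.univ) => spinAbs_nonneg a i
    rw [rhoQuot_vecSpin q a b σ hσ]
    linarith

/-- In the case of equality the component in `so_7` vanishes, and so do all `bⱼ` with the possible
exception of the largest one if `q = 10`. -/
theorem eq_zero_of_rhoQuot_le_vecSpin {q : ℕ} (hq : 4 ≤ q) (hq' : q ≤ 10) (a : Fin 3 → ℝ)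
    (b : Fin (q / 2) → ℝ) (σ : Equiv.Perm (Fin (q / 2)))
    (hσ : Monotone ((fun j => |b j|) ∘ σ))
    (h : rhoQuot (hSpin q) (vecSpin q a b) ≤ rhoSub (hSpin q) (vecSpin q a b)) :
    a = 0 ∧ ∀ j : Fin (q / 2), 2 * (j : ℕ) + q % 2 < 8 → b (σ j) = 0 := by
  have h1 := pairMax_add_le_gapSum (d := q % 2) (r := q / 2) (by omega) (by omega) (by omega) a
    (t := (fun j => |b j|) ∘ σ) fun j => abs_nonneg _
  rw [rhoQuot_vecSpin q a b σ hσ] at h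
  have h3 : ∑ i, spinAbs a i = 0 :=
    le_antisymm (by linarith) (Finset.sum_nonneg fun i _ => spinAbs_nonneg a i)
  have h4 : spinAbs a = 0 := by
    ext i
    exact (Finset.sum_eq_zero_iff_of_nonneg fun i _ => spinAbs_nonneg a i).1 h3 i
      (Finset.mem_univ i)
  refine ⟨(spinAbs_eq_zero_iff a).1 h4, fun j hj => ?_⟩
  have h2 := pairMax_le a
  rw [h4] at h
  have h5 := mul_eq_zero_of_gapSum_zero_left (m := 4) (d := q % 2) (r := q / 2)
    (t := (fun j => |b j|) ∘ σ) (by omega) (fun j => abs_nonneg _) (by linarith) j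
  have h6 : (2 * ((j : ℕ) : ℝ) + ((q % 2 : ℕ) : ℝ)) < 8 := by exact_mod_cast hj
  rcases mul_eq_zero.1 h5 with h7 | h7
  · push_cast at h7 h6
    linarith
  · exact abs_eq_zero.1 h7

/-- The test vector `a = (1, 1, 0)`, `b = 0`, which violates the inequality for small `q`. -/
theorem exists_vecSpin_small (q : ℕ) : ∃ Y ∈ aSpin q, 0 < rhoSub (hSpin q) Y ∧
    rhoQuot (hSpin q) Y = rhoSub (hSpin q) Y + (2 * q - 6) := by
  have h0 : (fun j : Fin (q / 2) => |(0 : Fin (q / 2) → ℝ) j|) ∘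
      (1 : Equiv.Perm (Fin (q / 2))) = 0 := by
    ext
    simp
  have hc : ∑ i, spinAbs ![1, 1, 0] i = 2 := by
    simp only [spinAbs, spinHalfWt, Fin.sum_univ_four, Matrix.cons_val]
    norm_num
  have hl : ∑ i, |(![1, 1, 0] : Fin 3 → ℝ) i| = 2 := by
    simp only [Fin.sum_univ_three, Matrix.cons_val]
    norm_num
  have hp : pairMax ![1, 1, 0] = 6 := by
    simp only [pairMax, Matrix.cons_val]
    norm_num
  refine ⟨vecSpin q ![1, 1, 0] 0, ⟨_, _, rfl⟩, ?_, ?_⟩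
  · rw [rhoSub_vecSpin q, hp, hl, torusWt_zero, rhoWt_zero]
    norm_num
  · rw [rhoQuot_vecSpin q _ 0 1 (by rw [h0]; exact monotone_const), h0,
      gapSum_zero_right _ (spinAbs_nonneg _), hc, hp]
    have h : 2 * ((q / 2 : ℕ) : ℝ) + ((q % 2 : ℕ) : ℝ) = q := by
      exact_mod_cast Nat.div_add_mod q 2
    rw [h]
    ring

theorem pairMax_zero : pairMax 0 = 0 := by
  simp [pairMax]

/-- The test vector `a = 0`, `b = (0, …, 0, 1)`, which violates the inequality for large `q`. -/
theorem exists_vecSpin_large {q : ℕ} (hq : 3 ≤ q) : ∃ Y ∈ aSpin q, 0 < rhoSub (hSpin q) Y ∧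
    rhoQuot (hSpin q) Y = rhoSub (hSpin q) Y + (10 - q) := by
  refine ⟨vecSpin q 0 (lastUnit _), ⟨_, _, rfl⟩, ?_, ?_⟩
  · rw [rhoSub_vecSpin q, pairMax_zero]
    have h1 := le_rhoWt_torusWt q hq (lastUnit _)
    have h2 := sum_abs_lastUnit_pos (r := q / 2) (by omega)
    simp only [Pi.zero_apply, abs_zero, Finset.sum_const_zero]
    linarith
  · rw [rhoQuot_vecSpin q _ _ 1 (monotone_abs_lastUnit _), (spinAbs_eq_zero_iff 0).2 rfl,
      gapSum_lastUnit (by omega), pairMax_zero]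
    push_cast
    ring

theorem rhoLE_hSpin_iff (q : ℕ) : RhoLE (hSpin q) (aSpin q) ↔ 3 ≤ q ∧ q ≤ 10 := by
  constructor
  · intro h
    constructor
    · obtain ⟨Y, hY, -, h1⟩ := exists_vecSpin_small q
      have h2 := h Y hY
      have h3 : (3 : ℝ) ≤ q := by linarith
      exact_mod_cast h3
    · by_contra! hq
      obtain ⟨Y, hY, -, h1⟩ := exists_vecSpin_large (q := q) (by omega)
      have h2 := h Y hY
      have h3 : (q : ℝ) ≤ 10 := by linarith
      exact absurd (by exact_mod_cast h3) (not_le.2 hq)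
  · rintro ⟨hq, hq'⟩ _ ⟨a, b, rfl⟩
    exact rhoSub_le_rhoQuot_vecSpin hq hq' a b

theorem rhoLT_hSpin_iff (q : ℕ) : RhoLT (hSpin q) (aSpin q) ↔ 4 ≤ q ∧ q ≤ 9 := by
  constructor
  · intro h
    constructor
    · obtain ⟨Y, hY, h0, h1⟩ := exists_vecSpin_small q
      have h2 := h Y hY (ne_zero_of_rhoSub_pos h0)
      have h3 : (3 : ℝ) < q := by linarith
      exact_mod_cast h3
    · by_contra! hq
      obtain ⟨Y, hY, h0, h1⟩ := exists_vecSpin_large (q := q) (by omega)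
      have h2 := h Y hY (ne_zero_of_rhoSub_pos h0)
      have h3 : (q : ℝ) < 10 := by linarith
      have h4 : q < 10 := by exact_mod_cast h3
      omega
  · rintro ⟨hq, hq'⟩ _ ⟨a, b, rfl⟩ hY
    by_contra! h
    obtain ⟨σ, hσ⟩ := exists_perm_monotone fun j => |b j|
    obtain ⟨h1, h2⟩ := eq_zero_of_rhoQuot_le_vecSpin hq (by omega) a b σ hσ h
    have h3 : b = 0 := abs_comp_perm_eq_zero (σ := σ) fun j => by
      have h4 := h2 j (by have := j.2; omega)
      simp [h4]
    rw [h1, h3, vecSpin_zero] at hY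
    exact hY rfl

theorem isWitness_vecSpin_three {a : Fin 3 → ℝ} (ha : a ∈ soChamber 7) (b : Fin 1 → ℝ) :
    IsWitness (hSpin 3) (vecSpin 3 a b) ↔ 0 < a 0 ∧ a 0 = a 1 ∧ a 2 = 0 ∧ b 0 = 0 := by
  obtain ⟨ha, ha'⟩ := ha
  have a0 : 0 ≤ a 0 := ha' (by decide) 0
  have a1 : 0 ≤ a 1 := ha' (by decide) 1
  have a2 : 0 ≤ a 2 := ha' (by decide) 2
  have h01 : a 1 ≤ a 0 := (le_abs_self _).trans (ha 0 1 (by decide))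
  have h12 : a 2 ≤ a 1 := (le_abs_self _).trans (ha 1 2 (by decide))
  have hp : pairMax a = 4 * a 0 + 2 * a 1 := by
    rw [pairMax, abs_of_nonneg a0, abs_of_nonneg a1, abs_of_nonneg a2, max_eq_left h01,
      max_eq_left (h12.trans h01), max_eq_left h12]
    ring
  have hb := abs_nonneg (b 0)
  rw [isWitness_iff_rhoSub_pos, rhoQuot_vecSpin_three, hp]
  simp only [spinAbs, Fin.sum_univ_four, spinHalfWt, Matrix.cons_val]
  rw [abs_of_nonneg (by linarith : 0 ≤ (a 0 + a 1 + a 2) / 2),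
    abs_of_nonneg (by linarith : 0 ≤ (a 0 + a 1 - a 2) / 2),
    abs_of_nonneg (by linarith : 0 ≤ (a 0 - a 1 + a 2) / 2)]
  constructor
  · rintro ⟨h, hpos⟩
    have l3 := le_abs_self ((a 0 - a 1 - a 2) / 2)
    have m0 := le_max_left ((a 0 + a 1 + a 2) / 2) |b 0|
    have m1 := le_max_left ((a 0 + a 1 - a 2) / 2) |b 0|
    have m2 := le_max_left ((a 0 - a 1 + a 2) / 2) |b 0|
    have m2' := le_max_right ((a 0 - a 1 + a 2) / 2) |b 0|
    have m3 := le_max_left |(a 0 - a 1 - a 2) / 2| |b 0|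
    have m3' := le_max_right |(a 0 - a 1 - a 2) / 2| |b 0|
    -- Together with the chamber inequalities, equality leaves `3 (a₁ - a₂) + a₃ ≤ 0` and `3 t ≤ 0`.
    have e1 : a 0 = a 1 := by linarith
    have e2 : a 2 = 0 := by linarith
    have e3 : b 0 = 0 := abs_eq_zero.1 (by linarith)
    refine ⟨a0.lt_of_ne' fun e0 => hpos.ne' ?_, e1, e2, e3⟩
    have ha0 : a = 0 := by
      ext i
      fin_cases i
      exacts [e0, e1.symm.trans e0, e2]
    have hb0 : b = 0 := by
      ext i
      fin_cases i
      exact e3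
    subst ha0 hb0
    exact (congrArg _ (vecSpin_zero 3)).trans (rhoSub_zero _)
  · rintro ⟨h0, e1, e2, e3⟩
    constructor
    · rw [e3, e2, ← e1]
      simp only [abs_zero, sub_self, zero_div, add_zero, sub_zero, max_self]
      rw [max_eq_left (by linarith)]
      ring
    · have h1 := le_rhoWt_torusWt 3 le_rfl b
      have h2 : 0 ≤ ∑ k : Fin (3 / 2), |b k| := Finset.sum_nonneg fun k _ => abs_nonneg _
      have h3 : 0 ≤ ∑ i, |a i| := Finset.sum_nonneg fun i _ => abs_nonneg _
      have h4 : rhoSub (hSpin 3) (vecSpin 3 a b) = _ := rhoSub_vecSpin 3 a b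
      rw [h4, hp]
      linarith

theorem isWitness_vecSpin_ten (a : Fin 3 → ℝ) {b : Fin 5 → ℝ} (hb : b ∈ soChamber 10) :
    IsWitness (hSpin 10) (vecSpin 10 a b) ↔
      0 < b 0 ∧ a 0 = 0 ∧ a 1 = 0 ∧ a 2 = 0 ∧ b 1 = 0 ∧ b 2 = 0 ∧ b 3 = 0 ∧ b 4 = 0 := by
  have hσ : Monotone ((fun j => |b j|) ∘ (Fin.revPerm : Equiv.Perm (Fin 5))) := by
    intro i j hij
    rcases hij.eq_or_lt with rfl | hij
    · exact le_rfl
    · exact (hb.1 _ _ (Fin.rev_lt_rev.2 hij)).trans (le_abs_self _)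
  have hb0 : 0 ≤ b 0 := (abs_nonneg _).trans (hb.1 0 1 (by decide))
  rw [isWitness_iff_rhoSub_pos]
  constructor
  · rintro ⟨h, hpos⟩
    obtain ⟨rfl, h1⟩ := eq_zero_of_rhoQuot_le_vecSpin (q := 10) (by norm_num) le_rfl a b
      Fin.revPerm hσ h.le
    have b1 : b 1 = 0 := h1 3 (by decide)
    have b2 : b 2 = 0 := h1 2 (by decide)
    have b3 : b 3 = 0 := h1 1 (by decide)
    have b4 : b 4 = 0 := h1 0 (by decide)
    refine ⟨hb0.lt_of_ne' fun b0 => hpos.ne' ?_, rfl, rfl, rfl, b1, b2, b3, b4⟩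
    have hz : b = 0 := by
      ext i
      fin_cases i <;> assumption
    subst hz
    exact (congrArg _ (vecSpin_zero 10)).trans (rhoSub_zero _)
  · rintro ⟨b0, a0, a1, a2, b1, b2, b3, b4⟩
    have hz : a = 0 := by
      ext i
      fin_cases i <;> assumption
    subst hz
    constructor
    · have h := rhoQuot_vecSpin 10 0 b Fin.revPerm hσ
      rw [(spinAbs_eq_zero_iff 0).2 rfl, pairMax_zero] at h
      have e : gapSum ((10 % 2 : ℕ) : ℝ) (0 : Fin 4 → ℝ)
          ((fun j => |b j|) ∘ (Fin.revPerm : Equiv.Perm (Fin 5))) = 0 := by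
        rw [gapSum_zero_left (t := (fun j => |b j|) ∘ (Fin.revPerm : Equiv.Perm (Fin 5))) _
          fun j => abs_nonneg _]
        simp [Fin.sum_univ_five, Fin.rev, b1, b2, b3, b4]
        norm_num
      refine h.trans ?_
      erw [e]
      simp
    · have h1 := le_rhoWt_torusWt 10 (by norm_num) b
      have h2 : 0 < ∑ k : Fin 5, |b k| :=
        Finset.sum_pos' (fun i _ => abs_nonneg _) ⟨0, Finset.mem_univ _, abs_pos.2 b0.ne'⟩
      have h4 : 0 ≤ ∑ i, |(0 : Fin 3 → ℝ) i| := Finset.sum_nonneg fun i _ => abs_nonneg _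
      have h6 : ∑ k : Fin 5, |b k| ≤ rhoWt (torusWt 10 b) := h1
      have h7 : rhoSub (hSpin 10) (vecSpin 10 0 b) = _ := rhoSub_vecSpin 10 0 b
      rw [h7, pairMax_zero]
      linarith

end Spin

end RhoIneq

theorem mainTheorem6 :
    (∀ q : ℕ, 1 ≤ q →
      (RhoLE (hG2 q) (aG2 q) ↔ 2 ≤ q ∧ q ≤ 9) ∧
      (RhoLT (hG2 q) (aG2 q) ↔ 3 ≤ q ∧ q ≤ 8)) ∧
    (∀ a ∈ g2Chamber, ∀ b : Fin 1 → ℝ, b ∈ soChamber 2 →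
      (IsWitness (hG2 2) (vecG2 2 a b) ↔ a ≠ 0 ∧ a 0 = a 1 ∧ b 0 = 0)) ∧
    (∀ a ∈ g2Chamber, ∀ b : Fin 4 → ℝ, b ∈ soChamber 9 →
      (IsWitness (hG2 9) (vecG2 9 a b) ↔
        0 < b 0 ∧ a 0 = 0 ∧ a 1 = 0 ∧ a 2 = 0 ∧ b 1 = 0 ∧ b 2 = 0 ∧ b 3 = 0)) ∧
    (∀ q : ℕ, 1 ≤ q →
      (RhoLE (hSpin q) (aSpin q) ↔ 3 ≤ q ∧ q ≤ 10) ∧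
      (RhoLT (hSpin q) (aSpin q) ↔ 4 ≤ q ∧ q ≤ 9)) ∧
    (∀ a : Fin 3 → ℝ, a ∈ soChamber 7 → ∀ b : Fin 1 → ℝ, b ∈ soChamber 3 →
      (IsWitness (hSpin 3) (vecSpin 3 a b) ↔ 0 < a 0 ∧ a 0 = a 1 ∧ a 2 = 0 ∧ b 0 = 0)) ∧
    (∀ a : Fin 3 → ℝ, a ∈ soChamber 7 → ∀ b : Fin 5 → ℝ, b ∈ soChamber 10 →
      (IsWitness (hSpin 10) (vecSpin 10 a b) ↔
        0 < b 0 ∧ a 0 = 0 ∧ a 1 = 0 ∧ a 2 = 0 ∧ b 1 = 0 ∧ b 2 = 0 ∧ b 3 = 0 ∧ b 4 = 0)) :=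
  ⟨fun q _ => ⟨rhoLE_hG2_iff q, rhoLT_hG2_iff q⟩,
    fun _ ha b _ => isWitness_vecG2_two ha b,
    fun _ ha _ hb => isWitness_vecG2_nine ha hb,
    fun q _ => ⟨rhoLE_hSpin_iff q, rhoLT_hSpin_iff q⟩,
    fun _ ha b _ => isWitness_vecSpin_three ha b,
    fun a _ _ hb => isWitness_vecSpin_ten a hb⟩
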